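/- There are absolute constants $C, c$ such that the following holds. Let $G=(V,E)$ be a connected undirected graph with $n$ vertices and positive edge weights, let $d_G$ be its shortest path metric, let $x_1,\dots,x_n$ be an arbitrary ranking of the vertices (the priority ranking), and let $t\ge 1$ be an integer. For $1\le j\le n$ put $k_j=\max\{1,\lceil t\log j/\log n\rceil\}$ (so $k_1=1$, and $k_j=\lceil t\log j/\log n\rceil$ for $j\ge 2$). Then there is a path-reporting distance oracle for $G$ that occupies at most $C\,t\,n^{1+1/t}$ words, where each word holds either an integer of at most $c(\lfloor\log_2 n\rfloor+1)$ bits or a distance between two vertices, and that has prioritized stretch $2k_j-1$ and query time $O(k_j)$. That is, for all $1\le j<i\le n$, when it is queried for the pair $x_j,x_i$ (in either order): (a) the oracle reports, in time at most $C\,k_j$, a number $\tilde d$ with $$d_G(x_j,x_i)\le\tilde d\le(2k_j-1)\,d_G(x_j,x_i);$$ (b) on a path query it outputs a path (a sequence of consecutively adjacent vertices) of $G$ between $x_j$ and $x_i$ of total weight at most $(2k_j-1)\,d_G(x_j,x_i)$, in time at most $C(\ell+k_j)$, where $\ell$ is the number of edges of this path. The query algorithms are two fixed programs, the same for all graphs,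 for a unit-cost word RAM with words of $c(\lfloor\log_2 n\rfloor+1)$ bits, on which distances can only be loaded and added. -/

import Mathlib

/-! ### Weighted graphs and the shortest path metric -/

/-- The total weight of a walk in a graph with edge weights `wt`. -/
def walkWeight {V : Type*} {G : SimpleGraph V} (wt : Sym2 V → ℝ) {u v : V}
    (p : G.Walk u v) : ℝ :=
  (p.edges.map wt).sum

/-- The shortest path distance `d_G(u, v)` of a connected graph with positive edge weights. -/
noncomputable def graphDist {V : Type*} (G : SimpleGraph V) (wt : Sym2 V → ℝ) (u v : V) : ℝ :=
  ⨅ p : G.Walk u v, walkWeight wt p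

/-! ### A unit-cost word RAM

Words are natural numbers below `2 ^ W`, where `W` is the word size in bits. A distance occupies one
word of its own kind: distance words can be loaded from the memory and added, and nothing else, so
no integer information can be extracted from them. -/

/-- The stored data: a contiguous array of integer words and a contiguous array of distance words.
It is read-only for the query programs. -/
structure Store where
  words : List ℕ
  dists : List ℝ

/-- The space: the total number of stored words. -/
def Store.space (D : Store) : ℕ := D.words.length + D.dists.length

/-- The state of the machine during a query: integer registers, distance registers, and a write-only
output array. -/
structure MachineState where
  reg : ℕ → ℕ
  dreg : ℕ → ℝ
  out : ℕ → ℕ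

/-- Arithmetic operations on words. -/
inductive WordOp where
  | add | sub | mul | div | mod

/-- Subtraction is truncated at zero and division by zero gives zero; overflow is treated in
`Instr.exec`. -/
def WordOp.eval : WordOp → ℕ → ℕ → ℕ
  | .add, a, b => a + b
  | .sub, a, b => a - b
  | .mul, a, b => a * b
  | .div, a, b => a / b
  | .mod, a, b => a % b

/-- Elementary instructions; all arguments are register numbers, except for the literal `k`. -/
inductive Instr where
  /-- `reg r := k` -/
  | const (r k : ℕ)
  /-- `reg r := reg a (op) reg b` -/
  | arith (op : WordOp) (r a b : ℕ)
  /-- `reg r := words[reg a]` -/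
  | load (r a : ℕ)
  /-- `dreg r := dists[reg a]` -/
  | loadDist (r a : ℕ)
  /-- `dreg r := dreg a + dreg b` -/
  | addDist (r a b : ℕ)
  /-- `out[reg a] := reg r` -/
  | write (a r : ℕ)

/-- The effect of one instruction with word size `W` and stored data `D`. Integer results are reduced
modulo `2 ^ W`; reading outside of the stored arrays gives zero. -/
noncomputable def Instr.exec (W : ℕ) (D : Store) : Instr → MachineState → MachineState
  | .const r k, s => { s with reg := Function.update s.reg r (k % 2 ^ W) }
  | .arith op r a b, s =>
      { s with reg := Function.update s.reg r (op.eval (s.reg a) (s.reg b) % 2 ^ W) }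
  | .load r a, s => { s with reg := Function.update s.reg r (D.words.getD (s.reg a) 0) }
  | .loadDist r a, s => { s with dreg := Function.update s.dreg r (D.dists.getD (s.reg a) 0) }
  | .addDist r a b, s => { s with dreg := Function.update s.dreg r (s.dreg a + s.dreg b) }
  | .write a r, s => { s with out := Function.update s.out (s.reg a) (s.reg r) }

/-- Programs. -/
inductive Prog where
  | skip
  | instr (i : Instr)
  | seq (p q : Prog)
  /-- `if reg a < reg b then p else q` -/
  | ifLt (a b : ℕ) (p q : Prog)
  /-- `while reg a < reg b do p` -/
  | whileLt (a b : ℕ) (p : Prog)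

/-- `Runs W D p s T s'`: started in the state `s`, the program `p` terminates in the state `s'` after
exactly `T` time units. Every instruction and every evaluation of a test costs one unit. -/
inductive Runs (W : ℕ) (D : Store) : Prog → MachineState → ℕ → MachineState → Prop where
  | skip (s : MachineState) : Runs W D .skip s 0 s
  | instr (i : Instr) (s : MachineState) : Runs W D (.instr i) s 1 (i.exec W D s)
  | seq {p q : Prog} {s s' s'' : MachineState} {T T' : ℕ} :
      Runs W D p s T s' → Runs W D q s' T' s'' → Runs W D (.seq p q) s (T + T') s''
  | ifTrue {a b : ℕ} {p q : Prog} {s s' : MachineState} {T : ℕ} :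
      s.reg a < s.reg b → Runs W D p s T s' → Runs W D (.ifLt a b p q) s (T + 1) s'
  | ifFalse {a b : ℕ} {p q : Prog} {s s' : MachineState} {T : ℕ} :
      ¬ s.reg a < s.reg b → Runs W D q s T s' → Runs W D (.ifLt a b p q) s (T + 1) s'
  | whileDone {a b : ℕ} {p : Prog} {s : MachineState} :
      ¬ s.reg a < s.reg b → Runs W D (.whileLt a b p) s 1 s
  | whileStep {a b : ℕ} {p : Prog} {s s' s'' : MachineState} {T T' : ℕ} :
      s.reg a < s.reg b → Runs W D p s T s' → Runs W D (.whileLt a b p) s' T' s'' →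
      Runs W D (.whileLt a b p) s (T + T' + 1) s''

/-- The initial state for a query about the vertices named `a` and `b`. -/
def queryState (a b : ℕ) : MachineState where
  reg := fun r => if r = 0 then a else if r = 1 then b else 0
  dreg := fun _ => 0
  out := fun _ => 0

/-! ### Distance oracles -/

/-- Word size: `c (⌊log₂ n⌋ + 1)` bits, for a constant `c`. -/
def wordSize (c n : ℕ) : ℕ := c * (Nat.log 2 n + 1)

/-- Every stored integer fits into a word, and every stored distance word is a distance between two
vertices of the graph. -/
def Store.WellFormed {V : Type*} (G : SimpleGraph V) (wt : Sym2 V → ℝ) (W : ℕ) (D : Store) : Prop :=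
  (∀ a ∈ D.words, a < 2 ^ W) ∧ (∀ d ∈ D.dists, ∃ u v : V, d = graphDist G wt u v)

/-- On the query `(u, v)` the program `P` halts after at most `τ` time units, and the distance it
reports, in the distance register `0`, is at least `d_G(u, v)` and at most `α · d_G(u, v)`. -/
def AnswersDistance {V : Type*} (G : SimpleGraph V) (wt : Sym2 V → ℝ) {n : ℕ} (name : V ≃ Fin n)
    (W : ℕ) (D : Store) (P : Prog) (u v : V) (α : ℝ) (τ : ℕ) : Prop :=
  ∃ (T : ℕ) (s : MachineState),
    Runs W D P (queryState (name u) (name v)) T s ∧ T ≤ τ ∧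
    graphDist G wt u v ≤ s.dreg 0 ∧ s.dreg 0 ≤ α * graphDist G wt u v

/-- On the query `(u, v)` the program `P` outputs a path of `G` from `u` to `v` of total weight at most
`α · d_G(u, v)`: its number `ℓ` of edges in the register `0`, and its vertices, in order, in the cells
`0, …, ℓ` of the output array. The running time is at most `κ · ℓ + τ`. -/
def ReportsPath {V : Type*} (G : SimpleGraph V) (wt : Sym2 V → ℝ) {n : ℕ} (name : V ≃ Fin n)
    (W : ℕ) (D : Store) (P : Prog) (u v : V) (α : ℝ) (κ τ : ℕ) : Prop :=
  ∃ (T : ℕ) (s : MachineState) (p : G.Walk u v),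
    Runs W D P (queryState (name u) (name v)) T s ∧ T ≤ κ * p.length + τ ∧
    s.reg 0 = p.length ∧ (∀ k ≤ p.length, s.out k = name (p.getVert k)) ∧
    walkWeight wt p ≤ α * graphDist G wt u v

/-- `⌈t log j / log n⌉`, replaced by `1` for `j = 1`, where the ceiling vanishes. For `2 ≤ j ≤ n` the
ceiling is at least `1` and the maximum has no effect. -/
noncomputable def priorityLevel (t n j : ℕ) : ℕ :=
  max 1 ⌈(t : ℝ) * Real.log j / Real.log n⌉₊

/-!
The oracle is that of Thorup and Zwick, on a hierarchy `V = A 0 ⊇ A 1 ⊇ … ⊇ A t = ∅` into which the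
priorities are built: a vertex of priority level `k` is forced into `A (t - k)`. As at most `n ^ (k / t)`
vertices have a priority level of at most `k`, this is affordable: sampling every level from the
preceding one with probability `n ^ (-1 / t)`, and adding the forced vertices, still leaves an expected
total bunch size of at most `2 t n ^ (1 + 1 / t)` (`exists_hierarchy`, by conditional expectations). The
bunch of `v` consists of the `w ∈ A i` that are closer to `v` than all of `A (i + 1)`. A query starts at
the level `t - k` with the vertex `u` of better priority, which is its own pivot there. If the pivot of
`u` is not in the bunch of `v`, the two vertices change roles and the level increases, which increases
the distance to the pivot by at most `d(u, v)` (`BunchSystem.step`). At the level `t - 1` every bunch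
contains all of `A (t - 1)`, so after at most `k - 1` steps a vertex `w` in both bunches is found, with
`d(u, w) + d(w, v) ≤ (2 (k - 1) + 1) d(u, v)` (`reach_search_vertices`). More than `n` levels
are of no use, since `n ^ (1 / n) ≤ 2`, so `t` is replaced by `min t n`; this keeps all addresses
polynomial in `n`.

The membership tests need a dictionary of linear size with constant worst-case query time. Double
displacement provides it (`exists_dictionary`): the pair `(v, w)` is moved to the row `v + C w`, with column
displacements `C` for which the squares of the row sizes have a linear sum, and then to the cell
`R (v + C w) + w` of one array, with row displacements `R` that are found by first fit.

For path queries, each entry `(v, w)` of the dictionary also holds the next vertex on a shortest path from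
`v` to `w`. The bunches are closed under next hops, so the path from `u` to `w` and the path from `v` to
`w` can both be followed by means of the dictionary (`reach_follow`).
-/

/-! ### Shortest paths -/

section Metric

variable {V : Type*} {G : SimpleGraph V} {wt : Sym2 V → ℝ}

theorem walkWeight_nonneg (hpos : ∀ e ∈ G.edgeSet, 0 < wt e) {u v : V} (p : G.Walk u v) :
    0 ≤ walkWeight wt p := by
  refine List.sum_nonneg fun x hx => ?_
  obtain ⟨e, he, rfl⟩ := List.mem_map.1 hx
  exact (hpos e (p.edges_subset_edgeSet he)).le

theorem walkWeight_cons {u v w : V} (h : G.Adj u v) (p : G.Walk v w) :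
    walkWeight wt (SimpleGraph.Walk.cons h p) = wt s(u, v) + walkWeight wt p := by
  simp [walkWeight]

theorem walkWeight_append {u v w : V} (p : G.Walk u v) (p' : G.Walk v w) :
    walkWeight wt (p.append p') = walkWeight wt p + walkWeight wt p' := by
  simp [walkWeight, SimpleGraph.Walk.edges_append]

theorem walkWeight_reverse {u v : V} (p : G.Walk u v) :
    walkWeight wt p.reverse = walkWeight wt p := by
  simp [walkWeight, List.sum_reverse]

theorem graphDist_le_walkWeight (hpos : ∀ e ∈ G.edgeSet, 0 < wt e) {u v : V} (p : G.Walk u v) :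
    graphDist G wt u v ≤ walkWeight wt p :=
  ciInf_le ⟨0, by rintro _ ⟨p', rfl⟩; exact walkWeight_nonneg hpos p'⟩ p

theorem graphDist_nonneg (hpos : ∀ e ∈ G.edgeSet, 0 < wt e) (u v : V) :
    0 ≤ graphDist G wt u v :=
  Real.iInf_nonneg fun p => walkWeight_nonneg hpos p

theorem graphDist_self (hpos : ∀ e ∈ G.edgeSet, 0 < wt e) (u : V) : graphDist G wt u u = 0 :=
  le_antisymm ((graphDist_le_walkWeight hpos SimpleGraph.Walk.nil).trans (by simp [walkWeight]))
    (graphDist_nonneg hpos u u)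

theorem le_graphDist (hG : G.Connected) {u v : V} {a : ℝ}
    (h : ∀ p : G.Walk u v, a ≤ walkWeight wt p) : a ≤ graphDist G wt u v :=
  haveI : Nonempty (G.Walk u v) := hG u v
  le_ciInf h

theorem graphDist_comm (hG : G.Connected) (hpos : ∀ e ∈ G.edgeSet, 0 < wt e) (u v : V) :
    graphDist G wt u v = graphDist G wt v u := by
  have key : ∀ u v : V, graphDist G wt u v ≤ graphDist G wt v u := fun u v =>
    le_graphDist hG fun p =>
      (graphDist_le_walkWeight hpos p.reverse).trans (walkWeight_reverse p).le
  exact le_antisymm (key u v) (key v u)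

theorem graphDist_triangle (hG : G.Connected) (hpos : ∀ e ∈ G.edgeSet, 0 < wt e) (u v w : V) :
    graphDist G wt u w ≤ graphDist G wt u v + graphDist G wt v w := by
  have h1 : ∀ p : G.Walk v w, graphDist G wt u w - walkWeight wt p ≤ graphDist G wt u v :=
    fun p => le_graphDist hG fun p' => by
      have := graphDist_le_walkWeight hpos (p'.append p)
      rw [walkWeight_append] at this
      linarith
  have h2 : graphDist G wt u w - graphDist G wt u v ≤ graphDist G wt v w :=
    le_graphDist hG fun p => by linarith [h1 p]
  linarith

/-- The first edge of a shortest path: as `V` is finite, the minimum over the neighbours `v'` of `v`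
of `wt (v v') + d(v', w)` is attained, and it is a lower bound for the weight of every walk. -/
theorem exists_next_hop [Finite V] (hG : G.Connected) (hpos : ∀ e ∈ G.edgeSet, 0 < wt e) {v w : V}
    (hvw : v ≠ w) :
    ∃ v', G.Adj v v' ∧ graphDist G wt v w = wt s(v, v') + graphDist G wt v' w := by
  have hne : (G.neighborSet v).Nonempty := by
    obtain ⟨p⟩ := hG v w
    cases p with
    | nil => exact absurd rfl hvw
    | cons h p => exact ⟨_, h⟩
  obtain ⟨v', hv', hmin⟩ := Set.exists_min_image (G.neighborSet v)
    (fun v' => wt s(v, v') + graphDist G wt v' w) (Set.toFinite _) hne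
  replace hv' : G.Adj v v' := hv'
  refine ⟨v', hv', le_antisymm ?_ (le_graphDist hG fun p => ?_)⟩
  · refine (graphDist_triangle hG hpos v v' w).trans (add_le_add_left ?_ _)
    refine (graphDist_le_walkWeight hpos (SimpleGraph.Walk.cons hv' SimpleGraph.Walk.nil)).trans ?_
    rw [walkWeight_cons]
    simp [walkWeight]
  · cases p with
    | nil => exact absurd rfl hvw
    | cons h p =>
      rw [walkWeight_cons]
      exact (hmin _ h).trans (add_le_add_right (graphDist_le_walkWeight hpos p) _)

/-- `nx` is a routing function: `nx v w` is the second vertex of a shortest path from `v` to `w`. -/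
def IsNextHop (G : SimpleGraph V) (wt : Sym2 V → ℝ) (nx : V → V → V) : Prop :=
  ∀ v w, v ≠ w → G.Adj v (nx v w) ∧
    graphDist G wt v w = wt s(v, nx v w) + graphDist G wt (nx v w) w

theorem exists_isNextHop [Finite V] (hG : G.Connected) (hpos : ∀ e ∈ G.edgeSet, 0 < wt e) :
    ∃ nx, IsNextHop G wt nx := by
  classical
  have : ∀ v w, ∃ v', v ≠ w → G.Adj v v' ∧
      graphDist G wt v w = wt s(v, v') + graphDist G wt v' w := fun v w => by
    by_cases h : v = w
    · exact ⟨v, fun h' => absurd h h'⟩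
    · obtain ⟨v', hv'⟩ := exists_next_hop hG hpos h
      exact ⟨v', fun _ => hv'⟩
  choose nx hnx using this
  exact ⟨nx, hnx⟩

/-- Following the next hops from `v` leads to `w` along a shortest path. Its number of edges is
bounded through the number of vertices that are closer to `w` than `v` is. -/
theorem exists_geodesic [Fintype V] (hpos : ∀ e ∈ G.edgeSet, 0 < wt e)
    {nx : V → V → V} (hnx : IsNextHop G wt nx) (v w : V) :
    ∃ p : G.Walk v w, walkWeight wt p = graphDist G wt v w ∧ p.length < Fintype.card V ∧
      (∀ k < p.length, p.getVert k ≠ w) ∧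
      (∀ k < p.length, p.getVert (k + 1) = nx (p.getVert k) w) := by
  classical
  let closer : V → Finset V := fun v =>
    Finset.univ.filter fun v' => graphDist G wt v' w < graphDist G wt v w
  have main : ∀ m v, (closer v).card = m →
      ∃ p : G.Walk v w, walkWeight wt p = graphDist G wt v w ∧ p.length ≤ m ∧
        (∀ k < p.length, p.getVert k ≠ w) ∧
        (∀ k < p.length, p.getVert (k + 1) = nx (p.getVert k) w) := by
    intro m
    induction m using Nat.strong_induction_on with
    | _ m ih =>
      intro v hv
      by_cases hvw : v = w
      · subst hvw
        exact ⟨SimpleGraph.Walk.nil, by simp [walkWeight, graphDist_self hpos], by simp,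
          by simp, by simp⟩
      obtain ⟨hadj, hd⟩ := hnx v w hvw
      have hlt : graphDist G wt (nx v w) w < graphDist G wt v w := by
        have := hpos s(v, nx v w) hadj
        linarith
      have hcard : (closer (nx v w)).card < m := by
        rw [← hv]
        refine Finset.card_lt_card (Finset.ssubset_iff_of_subset ?_ |>.2 ⟨nx v w, ?_, ?_⟩)
        · intro a ha
          simp only [closer, Finset.mem_filter, Finset.mem_univ, true_and] at ha ⊢
          exact ha.trans hlt
        · simpa [closer] using hlt
        · simp [closer]
      obtain ⟨p, hp1, hp2, hp3, hp4⟩ := ih _ hcard (nx v w) rfl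
      refine ⟨SimpleGraph.Walk.cons hadj p, ?_, ?_, ?_, ?_⟩
      · rw [walkWeight_cons, hp1, hd]
      · rw [SimpleGraph.Walk.length_cons]; omega
      · rintro (_ | k) hk
        · simpa using hvw
        · simpa using hp3 k (by simpa using hk)
      · rintro (_ | k) hk
        · simp
        · simpa using hp4 k (by simpa using hk)
  obtain ⟨p, hp1, hp2, hp3⟩ := main _ v rfl
  refine ⟨p, hp1, hp2.trans_lt ?_, hp3⟩
  refine Finset.card_lt_card (Finset.ssubset_univ_iff.2 fun h => ?_)
  have : v ∈ closer v := h ▸ Finset.mem_univ v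
  simp [closer] at this

end Metric

/-! ### Sampling and the hierarchy of vertex sets -/

section Sampling

/-- Conditional expectations: if every element of `A` is sampled independently with probability `p`,
then the expected number of sets `T i` that are missed plus `lam` times the size of the sample is the
right-hand side, so some sample does at least as well. -/
theorem exists_sample {α ι : Type*} [DecidableEq α] {p lam : ℝ} (hp0 : 0 ≤ p) (hp1 : p ≤ 1)
    (A : Finset α) : ∀ (I : Finset ι) (T : ι → Finset α), (∀ i ∈ I, T i ⊆ A) →
      ∃ R ⊆ A, ((I.filter fun i => Disjoint (T i) R).card : ℝ) + lam * R.card ≤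
        ∑ i ∈ I, (1 - p) ^ (T i).card + lam * (p * A.card) := by
  induction A using Finset.induction_on with
  | empty =>
    intro I T hT
    refine ⟨∅, subset_rfl, ?_⟩
    have : ∀ i ∈ I, (1 - p) ^ (T i).card = (1 : ℝ) := fun i hi => by
      rw [Finset.subset_empty.1 (hT i hi)]; simp
    rw [Finset.sum_congr rfl this]
    simp
  | insert a A ha ih =>
    intro I T hT
    classical
    -- The two branches of the experiment: `a` is sampled, or it is not.
    obtain ⟨R₁, hR₁, h₁⟩ := ih (I.filter fun i => a ∉ T i) T (fun i hi => by
      rw [Finset.mem_filter] at hi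
      exact (Finset.subset_insert_iff_of_notMem hi.2).1 (hT i hi.1))
    obtain ⟨R₀, hR₀, h₀⟩ := ih I (fun i => (T i).erase a) (fun i hi =>
      Finset.subset_insert_iff.1 (hT i hi))
    have hsplit : ∑ i ∈ I, (1 - p) ^ (T i).card =
        p * ∑ i ∈ I.filter (fun i => a ∉ T i), (1 - p) ^ (T i).card +
        (1 - p) * ∑ i ∈ I, (1 - p) ^ ((T i).erase a).card := by
      rw [Finset.sum_filter, Finset.mul_sum, Finset.mul_sum, ← Finset.sum_add_distrib]
      refine Finset.sum_congr rfl fun i _ => ?_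
      by_cases h : a ∈ T i
      · have : (T i).card = ((T i).erase a).card + 1 := (Finset.card_erase_add_one h).symm
        simp only [h, not_true_eq_false, if_false, mul_zero, zero_add]
        rw [this, pow_succ]; ring
      · simp only [h, not_false_eq_true, if_true, Finset.erase_eq_of_notMem h]; ring
    have hc : ((insert a A).card : ℝ) = A.card + 1 := by
      rw [Finset.card_insert_of_notMem ha]; push_cast; rfl
    rw [hsplit, hc]
    have haR₁ : a ∉ R₁ := fun h => ha (hR₁ h)
    have haR₀ : a ∉ R₀ := fun h => ha (hR₀ h)
    have e₁ : I.filter (fun i => Disjoint (T i) (insert a R₁)) =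
        (I.filter fun i => a ∉ T i).filter fun i => Disjoint (T i) R₁ := by
      ext i; simp [Finset.disjoint_insert_right, and_assoc]
    have e₀ : I.filter (fun i => Disjoint (T i) R₀) =
        I.filter fun i => Disjoint ((T i).erase a) R₀ := by
      refine Finset.filter_congr fun i _ => ?_
      rw [Finset.disjoint_erase_comm, Finset.erase_eq_of_notMem haR₀]
    by_contra hcon
    have c₁ := not_le.1 fun h => hcon ⟨insert a R₁, Finset.insert_subset_insert a hR₁, h⟩
    have c₀ := not_le.1 fun h => hcon ⟨R₀, hR₀.trans (Finset.subset_insert a A), h⟩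
    rw [e₁, Finset.card_insert_of_notMem haR₁] at c₁
    rw [e₀] at c₀
    push_cast at c₁
    have d₁ := c₁.trans_le (by linarith : _ ≤
      ∑ i ∈ I with a ∉ T i, (1 - p) ^ (T i).card + lam * (p * A.card) + lam)
    have d₀ := c₀.trans_le h₀
    -- The average of the two bounds with the weights `p` and `1 - p` is the right-hand side.
    rcases le_total (∑ i ∈ I with a ∉ T i, (1 - p) ^ (T i).card + lam)
      (∑ i ∈ I, (1 - p) ^ ((T i).erase a).card) with h | h
    · nlinarith [mul_le_mul_of_nonneg_left h (sub_nonneg.2 hp1)]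
    · nlinarith [mul_le_mul_of_nonneg_left h hp0]

/-- If the elements of `A` are listed in increasing order of `f`, then the `k`-th one has at least
`k` elements before or at it, so the sum is dominated by a geometric series. -/
theorem sum_pow_card_le {α : Type*} [DecidableEq α] (f : α → ℝ) {r : ℝ} (h0 : 0 ≤ r) (h1 : r ≤ 1)
    (A : Finset α) :
    (∑ w ∈ A, r ^ (A.filter fun w' => f w' ≤ f w).card) * (1 - r) ≤ 1 - r ^ A.card := by
  induction A using Finset.induction_on_max_value f with
  | empty => simp
  | insert a A ha hmax ih =>
    have hfull : (insert a A).filter (fun w' => f w' ≤ f a) = insert a A :=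
      Finset.filter_true_of_mem fun w' hw' => by
        rcases Finset.mem_insert.1 hw' with rfl | h
        · exact le_rfl
        · exact hmax _ h
    rw [Finset.sum_insert ha, hfull, Finset.card_insert_of_notMem ha]
    have hle : ∑ w ∈ A, r ^ ((insert a A).filter fun w' => f w' ≤ f w).card ≤
        ∑ w ∈ A, r ^ (A.filter fun w' => f w' ≤ f w).card :=
      Finset.sum_le_sum fun w _ => pow_le_pow_of_le_one h0 h1
        (Finset.card_le_card (Finset.filter_subset_filter _ (Finset.subset_insert a A)))
    have hr := sub_nonneg.2 h1
    have := mul_le_mul_of_nonneg_right hle hr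
    have h2 : r ^ (A.card + 1) * (1 - r) ≤ r ^ A.card * (1 - r) :=
      mul_le_mul_of_nonneg_right (pow_le_pow_of_le_one h0 h1 (Nat.le_succ _)) hr
    have h3 : r ^ A.card * (1 - r) = r ^ A.card - r ^ (A.card + 1) := by ring
    rw [add_mul]
    linarith

variable {V : Type*}

open Classical in
/-- The part of the bunch of `v` that one level `A` of the hierarchy contributes: the vertices of `A`
that are closer to `v` than every vertex of the next level `A'`. -/
noncomputable def bunch (d : V → V → ℝ) (A A' : Finset V) (v : V) : Finset V :=
  A.filter fun w => ∀ w' ∈ A', d w v < d w' v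

theorem mem_bunch {d : V → V → ℝ} {A A' : Finset V} {v w : V} :
    w ∈ bunch d A A' v ↔ w ∈ A ∧ ∀ w' ∈ A', d w v < d w' v := by
  simp [bunch]

/-- One level of the hierarchy, sampled with probability `1 / q`: the expected bunch sizes are at
most `q`. -/
theorem exists_next_level [Fintype V] (d : V → V → ℝ) {q lam : ℝ} (hq : 1 ≤ q) (A : Finset V) :
    ∃ R ⊆ A, ((∑ v, (bunch d A R v).card : ℕ) : ℝ) + lam * R.card ≤
      Fintype.card V * q + lam * (A.card / q) := by
  classical
  have hq0 : 0 < q := by linarith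
  have hp0 : (0 : ℝ) ≤ 1 / q := by positivity
  have hp1 : 1 / q ≤ 1 := (div_le_one hq0).2 hq
  obtain ⟨R, hR, h⟩ := exists_sample (lam := lam) hp0 hp1 A ((Finset.univ : Finset V) ×ˢ A)
    (fun e => A.filter fun w' => d w' e.1 ≤ d e.2 e.1) (fun _ _ => Finset.filter_subset _ _)
  refine ⟨R, hR, ?_⟩
  have hcount : ∑ v, (bunch d A R v).card ≤
      (((Finset.univ : Finset V) ×ˢ A).filter fun e =>
        Disjoint (A.filter fun w' => d w' e.1 ≤ d e.2 e.1) R).card := by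
    rw [← Finset.card_sigma]
    refine Finset.card_le_card_of_injOn (fun e => (e.1, e.2)) ?_ ?_
    · rintro ⟨v, w⟩ hvw
      have hvw := mem_bunch.1 (Finset.mem_sigma.1 hvw).2
      refine Finset.mem_coe.2 (Finset.mem_filter.2 ⟨by simpa using hvw.1, ?_⟩)
      refine Finset.disjoint_left.2 fun w' hw' hw'R => ?_
      exact absurd (Finset.mem_filter.1 hw').2 (not_le.2 (hvw.2 w' hw'R))
    · rintro ⟨v, w⟩ _ ⟨v', w'⟩ _ h
      simp only [Prod.mk.injEq] at h
      obtain ⟨rfl, rfl⟩ := h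
      rfl
  have hsum : ∑ e ∈ (Finset.univ : Finset V) ×ˢ A,
      (1 - 1 / q) ^ (A.filter fun w' => d w' e.1 ≤ d e.2 e.1).card ≤ Fintype.card V * q := by
    rw [Finset.sum_product]
    calc _ ≤ ∑ _v : V, q := Finset.sum_le_sum fun v _ => ?_
      _ = _ := by simp
    have := sum_pow_card_le (fun w => d w v) (sub_nonneg.2 hp1) (sub_le_self 1 hp0) A
    have h2 : 0 ≤ (1 - 1 / q) ^ A.card := pow_nonneg (sub_nonneg.2 hp1) _
    rw [sub_sub_cancel, mul_one_div, div_le_iff₀ hq0] at this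
    nlinarith
  have : ((∑ v, (bunch d A R v).card : ℕ) : ℝ) ≤ _ := Nat.cast_le.2 hcount
  have e : 1 / q * (A.card : ℝ) = A.card / q := by ring
  rw [e] at h
  linarith

theorem bunch_anti (d : V → V → ℝ) (A : Finset V) {A' A'' : Finset V} (h : A' ⊆ A'') (v : V) :
    bunch d A A'' v ⊆ bunch d A A' v := fun _ hw =>
  mem_bunch.2 ⟨(mem_bunch.1 hw).1, fun w' hw' => (mem_bunch.1 hw).2 w' (h hw')⟩

/-- The levels of the hierarchy above a given one: the vertex `v` is forced to belong to the levels
up to `lev v`, and the other vertices are sampled. The term `Fintype.card V / q ^ m * A₀.card`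
accounts for the `m` further rounds of sampling that `A₀` goes through. -/
theorem exists_hierarchy_above [Fintype V] (d : V → V → ℝ) {q : ℝ} (hq : 1 ≤ q) (lev : V → ℕ)
    {t : ℕ} (hlev : ∀ v, lev v < t)
    (hS : ∀ i < t, (Nat.card {v // i ≤ lev v} : ℝ) ≤ q ^ (t - i)) (m : ℕ) :
    ∀ (i : ℕ), i + m + 1 = t → ∀ A₀ : Finset V, (∀ v, i ≤ lev v → v ∈ A₀) →
      ∃ A : ℕ → Finset V, A 0 = A₀ ∧ (∀ k, A (k + 1) ⊆ A k) ∧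
        (∀ k v, i + k ≤ lev v → v ∈ A k) ∧ A (m + 1) = ∅ ∧
        ((∑ k ∈ Finset.range (m + 1), ∑ v, (bunch d (A k) (A (k + 1)) v).card : ℕ) : ℝ) ≤
          Fintype.card V / q ^ m * A₀.card + 2 * m * (Fintype.card V * q) := by
  classical
  have hq0 : 0 < q := by linarith
  induction m with
  | zero =>
    intro i hi A₀ hA₀
    refine ⟨fun k => if k = 0 then A₀ else ∅, by simp, by simp, ?_, by simp, ?_⟩
    · rintro (_ | k) v hv
      · simpa using hA₀ v hv
      · have := hlev v; omega
    · have : ∀ v ∈ (Finset.univ : Finset V), (bunch d A₀ ∅ v).card ≤ A₀.card := fun v _ =>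
        Finset.card_le_card fun w hw => (mem_bunch.1 hw).1
      have := Finset.sum_le_card_nsmul _ _ _ this
      simp only [zero_add, Finset.sum_range_one, if_true, one_ne_zero, if_false, pow_zero, div_one,
        Nat.cast_zero, mul_zero, zero_mul, add_zero]
      exact_mod_cast this
  | succ m ih =>
    intro i hi A₀ hA₀
    obtain ⟨R, hR, hcost⟩ := exists_next_level d (lam := Fintype.card V / q ^ m) hq A₀
    let S : Finset V := Finset.univ.filter fun v => i + 1 ≤ lev v
    have hScard : (S.card : ℝ) ≤ q ^ (m + 1) := by
      have := hS (i + 1) (by omega)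
      rwa [Nat.card_eq_fintype_card, Fintype.card_subtype, show t - (i + 1) = m + 1 by omega] at this
    obtain ⟨A, hA0, hAanti, hAS, hAend, hAcost⟩ := ih (i + 1) (by omega) (R ∪ S)
      (fun v hv => Finset.mem_union_right _ (by simpa [S] using hv))
    refine ⟨fun k => if k = 0 then A₀ else A (k - 1), by simp, ?_, ?_, by simpa using hAend, ?_⟩
    · rintro (_ | k)
      · simp only [zero_add, one_ne_zero, if_false, Nat.sub_self, if_true, hA0]
        refine Finset.union_subset hR fun v hv => hA₀ v ?_
        have : i + 1 ≤ lev v := by simpa [S] using hv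
        omega
      · simpa using hAanti k
    · rintro (_ | k) v hv
      · simpa using hA₀ v hv
      · simpa using hAS k v (by omega)
    · rw [Finset.sum_range_succ']
      simp only [Nat.add_sub_cancel, Nat.succ_ne_zero, if_false, if_true, zero_add, Nat.sub_self,
        hA0]
      have h1 : ((∑ v, (bunch d A₀ (R ∪ S) v).card : ℕ) : ℝ) ≤
          ((∑ v, (bunch d A₀ R v).card : ℕ) : ℝ) := by
        exact_mod_cast Finset.sum_le_sum fun v _ =>
          Finset.card_le_card (bunch_anti d A₀ Finset.subset_union_left v)
      have h2 : ((R ∪ S).card : ℝ) ≤ R.card + S.card := by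
        exact_mod_cast Finset.card_union_le R S
      have hl : (0 : ℝ) ≤ Fintype.card V / q ^ m := by positivity
      have h3 : (Fintype.card V / q ^ m : ℝ) * (R ∪ S).card ≤
          Fintype.card V / q ^ m * R.card + Fintype.card V * q := by
        calc _ ≤ (Fintype.card V / q ^ m : ℝ) * (R.card + q ^ (m + 1)) :=
              mul_le_mul_of_nonneg_left (h2.trans (by linarith)) hl
          _ = _ := by field_simp; ring
      have h4 : (Fintype.card V / q ^ m : ℝ) * (A₀.card / q) =
          Fintype.card V / q ^ (m + 1) * A₀.card := by
        rw [pow_succ]; field_simp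
      push_cast at hAcost hcost h1 ⊢
      rw [h4] at hcost
      linarith

/-- The hierarchy with prioritized levels. The two terms `Fintype.card V * q` per level come from the
sampling and from the vertices that are forced into the level. -/
theorem exists_hierarchy [Fintype V] (d : V → V → ℝ) {q : ℝ} (hq : 1 ≤ q) (lev : V → ℕ)
    {t : ℕ} (ht : 1 ≤ t) (hqt : q ^ t = Fintype.card V) (hlev : ∀ v, lev v < t)
    (hS : ∀ i < t, (Nat.card {v // i ≤ lev v} : ℝ) ≤ q ^ (t - i)) :
    ∃ A : ℕ → Finset V, (∀ k, A (k + 1) ⊆ A k) ∧ (∀ k v, k ≤ lev v → v ∈ A k) ∧ A t = ∅ ∧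
      ((∑ k ∈ Finset.range t, ∑ v, (bunch d (A k) (A (k + 1)) v).card : ℕ) : ℝ) ≤
        2 * t * (Fintype.card V * q) := by
  obtain ⟨m, rfl⟩ : ∃ m, t = m + 1 := ⟨t - 1, by omega⟩
  have hq0 : 0 < q := by linarith
  obtain ⟨A, _, h1, h2, h3, h4⟩ := exists_hierarchy_above d hq lev hlev hS m 0 (by omega)
    Finset.univ (fun v _ => Finset.mem_univ v)
  refine ⟨A, h1, fun k v hk => h2 k v (by omega), h3, h4.trans ?_⟩
  have : (Fintype.card V / q ^ m : ℝ) * (Finset.univ : Finset V).card = Fintype.card V * q := by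
    rw [Finset.card_univ, ← hqt, pow_succ]; field_simp
  rw [this]
  push_cast
  have : 0 ≤ (Fintype.card V : ℝ) * q := by positivity
  nlinarith

end Sampling

/-! ### A static dictionary: double displacement -/

section Dictionary

/-- First fit in order of decreasing size: the rows of a sparse matrix, `E ρ` being the set of the
nonzero columns of the row `ρ`, can be shifted into one array without collisions. When a row of size
`s` is placed, every row that is already there has size at least `s`, so the number of forbidden
shifts is at most the sum of the squares of the row sizes. -/
theorem exists_row_displacement {α : Type*} [DecidableEq α] (E : α → Finset ℕ) {M : ℕ}
    (I : Finset α) (hM : ∑ ρ ∈ I, (E ρ).card ^ 2 ≤ M) :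
    ∃ R : α → ℕ, (∀ ρ, R ρ ≤ M) ∧
      ∀ ρ ∈ I, ∀ ρ' ∈ I, ∀ w ∈ E ρ, ∀ w' ∈ E ρ', R ρ + w = R ρ' + w' → ρ = ρ' := by
  induction I using Finset.induction_on_min_value (fun ρ => (E ρ).card) with
  | empty => exact ⟨fun _ => 0, by simp, by simp⟩
  | insert a I ha hmin ih =>
    rw [Finset.sum_insert ha] at hM
    obtain ⟨R, hR, hinj⟩ := ih (by omega)
    let bad : Finset ℕ := (E a ×ˢ I.sigma E).image fun e => R e.2.1 + e.2.2 - e.1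
    have hbad : bad.card < (Finset.range (M + 1)).card := by
      rw [Finset.card_range]
      refine Nat.lt_succ_of_le (Finset.card_image_le.trans ?_)
      rw [Finset.card_product, Finset.card_sigma, Finset.mul_sum]
      refine le_trans (Finset.sum_le_sum fun ρ hρ => ?_) (le_trans (Nat.le_add_left _ _) hM)
      rw [pow_two]
      exact Nat.mul_le_mul_right _ (hmin ρ hρ)
    obtain ⟨r, hr, hrbad⟩ := Finset.exists_mem_notMem_of_card_lt_card hbad
    have hr' : ∀ ρ ∈ I, ∀ w ∈ E a, ∀ w' ∈ E ρ, r + w ≠ R ρ + w' := fun ρ hρ w hw w' hw' h =>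
      hrbad (Finset.mem_image.2 ⟨(w, ⟨ρ, w'⟩), by simp [hw, hw', hρ], by simp only; omega⟩)
    have hne : ∀ ρ ∈ I, ρ ≠ a := fun ρ hρ h => ha (h ▸ hρ)
    refine ⟨Function.update R a r, fun ρ => ?_, ?_⟩
    · by_cases h : ρ = a
      · subst h; simpa using Nat.lt_succ_iff.1 (Finset.mem_range.1 hr)
      · simpa [h] using hR ρ
    · intro ρ hρ ρ' hρ' w hw w' hw' h
      rcases Finset.mem_insert.1 hρ with rfl | h1 <;> rcases Finset.mem_insert.1 hρ' with h2 | h2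
      · exact h2.symm
      · rw [Function.update_self, Function.update_of_ne (hne _ h2)] at h
        exact absurd h (hr' _ h2 _ hw _ hw')
      · subst h2
        rw [Function.update_self, Function.update_of_ne (hne _ h1)] at h
        exact absurd h.symm (hr' _ h1 _ hw' _ hw)
      · rw [Function.update_of_ne (hne _ h1), Function.update_of_ne (hne _ h2)] at h
        exact hinj _ h1 _ h2 _ hw _ hw' h

/-- Shifting the columns of a sparse matrix with the set `K` of nonzero positions so that the sum of
the squares of the row sizes becomes linear in the number of nonzeros. A column with `e` entries meets,
on the average over all its `K.card + 1` possible shifts, at most `e` of the entries that are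
already placed. -/
theorem exists_column_displacement (K : Finset (ℕ × ℕ)) (W : Finset ℕ) :
    ∃ C : ℕ → ℕ, (∀ w, C w ≤ K.card) ∧
      (((K.filter fun e => e.2 ∈ W) ×ˢ (K.filter fun e => e.2 ∈ W)).filter
        fun z => z.1.1 + C z.1.2 = z.2.1 + C z.2.2).card ≤ 3 * (K.filter fun e => e.2 ∈ W).card := by
  classical
  induction W using Finset.induction_on with
  | empty => exact ⟨fun _ => 0, by simp, by simp⟩
  | insert w₀ W hw₀ ih =>
    obtain ⟨C, hC, hcoll⟩ := ih
    set old := K.filter fun e => e.2 ∈ W with hold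
    set col := K.filter fun e => e.2 = w₀ with hcol
    have hunion : K.filter (fun e => e.2 ∈ insert w₀ W) = col ∪ old := by
      ext e; simp only [hold, hcol, Finset.mem_filter, Finset.mem_union, Finset.mem_insert]; tauto
    have hdisj : Disjoint col old := by
      refine Finset.disjoint_left.2 fun e h1 h2 => hw₀ ?_
      rw [← (Finset.mem_filter.1 h1).2]; exact (Finset.mem_filter.1 h2).2
    -- The new collisions that the shift `c` causes.
    let X : ℕ → Finset ((ℕ × ℕ) × (ℕ × ℕ)) := fun c =>
      (col ×ˢ old).filter fun z => z.1.1 + c = z.2.1 + C z.2.2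
    have hsum : ∑ c ∈ Finset.range (K.card + 1), (X c).card ≤
        ∑ _c ∈ Finset.range (K.card + 1), col.card := by
      calc ∑ c ∈ Finset.range (K.card + 1), (X c).card
          = ((Finset.range (K.card + 1)).sigma X).card := (Finset.card_sigma _ _).symm
        _ ≤ (col ×ˢ old).card := by
            refine Finset.card_le_card_of_injOn (fun z => z.2) ?_ ?_
            · rintro ⟨c, z⟩ hz
              exact (Finset.mem_filter.1 (Finset.mem_sigma.1 hz).2).1
            · rintro ⟨c, z⟩ hz ⟨c', z'⟩ hz' h
              have h1 := (Finset.mem_filter.1 (Finset.mem_sigma.1 hz).2).2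
              have h2 := (Finset.mem_filter.1 (Finset.mem_sigma.1 hz').2).2
              simp only at h h1 h2
              subst h
              have : c = c' := by omega
              rw [this]
        _ = old.card * col.card := by rw [Finset.card_product, mul_comm]
        _ ≤ (K.card + 1) * col.card := Nat.mul_le_mul_right _
            ((Finset.card_le_card (Finset.filter_subset _ _)).trans (Nat.le_succ _))
        _ = _ := by simp
    obtain ⟨c, hc, hXc⟩ := Finset.exists_le_of_sum_le ⟨0, by simp⟩ hsum
    refine ⟨Function.update C w₀ c, fun w => ?_, ?_⟩
    · by_cases h : w = w₀
      · subst h; simpa using Nat.lt_succ_iff.1 (Finset.mem_range.1 hc)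
      · simpa [h] using hC w
    rw [hunion, Finset.card_union_of_disjoint hdisj]
    have hsub : ((col ∪ old) ×ˢ (col ∪ old)).filter (fun z =>
          z.1.1 + Function.update C w₀ c z.1.2 = z.2.1 + Function.update C w₀ c z.2.2) ⊆
        (((old ×ˢ old).filter fun z => z.1.1 + C z.1.2 = z.2.1 + C z.2.2) ∪
          col.image fun e => (e, e)) ∪ (X c ∪ (X c).image Prod.swap) := by
      rintro ⟨⟨v, w⟩, ⟨v', w'⟩⟩ hz
      rw [Finset.mem_filter, Finset.mem_product, Finset.mem_union, Finset.mem_union] at hz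
      obtain ⟨⟨h1, h2⟩, h3⟩ := hz
      have hcol2 : ∀ {v w}, (v, w) ∈ col → w = w₀ := fun h => (Finset.mem_filter.1 h).2
      have hold2 : ∀ {v w}, (v, w) ∈ old → w ≠ w₀ := fun h h' =>
        hw₀ (h' ▸ (Finset.mem_filter.1 h).2)
      simp only [Finset.mem_union, Finset.mem_image, X, Finset.mem_filter, Finset.mem_product]
      rcases h1 with h1 | h1 <;> rcases h2 with h2 | h2
      · obtain rfl := hcol2 h1
        obtain rfl := hcol2 h2
        simp only [Function.update_self] at h3
        obtain rfl : v = v' := by omega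
        exact Or.inl (Or.inr ⟨_, h1, rfl⟩)
      · rw [hcol2 h1, Function.update_self, Function.update_of_ne (hold2 h2)] at h3
        exact Or.inr (Or.inl ⟨⟨h1, h2⟩, h3⟩)
      · rw [hcol2 h2, Function.update_self, Function.update_of_ne (hold2 h1)] at h3
        exact Or.inr (Or.inr ⟨((v', w'), (v, w)), ⟨⟨h2, h1⟩, h3.symm⟩, rfl⟩)
      · simp only [Function.update_of_ne (hold2 h1), Function.update_of_ne (hold2 h2)] at h3
        exact Or.inl (Or.inl ⟨⟨h1, h2⟩, h3⟩)
    have b1 := Finset.card_le_card hsub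
    have b2 := Finset.card_union_le (((old ×ˢ old).filter fun z => z.1.1 + C z.1.2 = z.2.1 + C z.2.2) ∪
          col.image fun e => (e, e)) (X c ∪ (X c).image Prod.swap)
    have b3 := Finset.card_union_le ((old ×ˢ old).filter fun z => z.1.1 + C z.1.2 = z.2.1 + C z.2.2)
          (col.image fun e => (e, e))
    have b4 := Finset.card_union_le (X c) ((X c).image Prod.swap)
    have b5 : (col.image fun e => (e, e)).card ≤ col.card := Finset.card_image_le
    have b6 : ((X c).image Prod.swap).card ≤ (X c).card := Finset.card_image_le
    omega

/-- The double displacement dictionary of Tarjan and Yao: the position `(v, w)` of a sparse matrix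
goes to the row `v + C w`, and from there to the cell `R (v + C w) + w` of a single array. -/
theorem exists_dictionary (K : Finset (ℕ × ℕ)) :
    ∃ C R : ℕ → ℕ, (∀ w, C w ≤ K.card) ∧ (∀ ρ, R ρ ≤ 3 * K.card) ∧
      Set.InjOn (fun e : ℕ × ℕ => R (e.1 + C e.2) + e.2) K := by
  classical
  obtain ⟨C, hC, hcoll⟩ := exists_column_displacement K (K.image Prod.snd)
  rw [Finset.filter_true_of_mem fun e he => Finset.mem_image_of_mem _ he] at hcoll
  let row : ℕ × ℕ → ℕ := fun e => e.1 + C e.2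
  let E : ℕ → Finset ℕ := fun ρ => (K.filter fun e => row e = ρ).image Prod.snd
  have hsq : ∑ ρ ∈ K.image row, (E ρ).card ^ 2 ≤ 3 * K.card := by
    refine le_trans ?_ hcoll
    calc ∑ ρ ∈ K.image row, (E ρ).card ^ 2
        ≤ ∑ ρ ∈ K.image row, ((K.filter fun e => row e = ρ) ×ˢ (K.filter fun e => row e = ρ)).card :=
          Finset.sum_le_sum fun ρ _ => by
            rw [Finset.card_product, ← pow_two]
            exact Nat.pow_le_pow_left Finset.card_image_le 2
      _ = ((K.image row).sigma fun ρ =>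
            (K.filter fun e => row e = ρ) ×ˢ (K.filter fun e => row e = ρ)).card :=
          (Finset.card_sigma _ _).symm
      _ ≤ _ := by
          refine Finset.card_le_card_of_injOn (fun z => z.2) ?_ ?_
          · rintro ⟨ρ, e, e'⟩ hz
            have hz := (Finset.mem_sigma.1 hz).2
            simp only [Finset.mem_product, Finset.mem_filter] at hz
            simp only [Finset.coe_filter, Set.mem_ofPred_eq, Finset.mem_product]
            exact ⟨⟨hz.1.1, hz.2.1⟩, hz.1.2.trans hz.2.2.symm⟩
          · rintro ⟨ρ, e, e'⟩ hz ⟨ρ', f, f'⟩ hz' h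
            have hz := (Finset.mem_sigma.1 hz).2
            have hz' := (Finset.mem_sigma.1 hz').2
            simp only [Finset.mem_product, Finset.mem_filter] at hz hz' h
            obtain ⟨rfl, rfl⟩ := Prod.mk.inj h
            obtain rfl : ρ = ρ' := hz.1.2.symm.trans hz'.1.2
            rfl
  obtain ⟨R, hR, hinj⟩ := exists_row_displacement E (K.image row) hsq
  refine ⟨C, R, hC, hR, ?_⟩
  rintro ⟨v, w⟩ he ⟨v', w'⟩ he' h
  have hE : ∀ e ∈ K, e.2 ∈ E (row e) := fun e he =>
    Finset.mem_image_of_mem _ (Finset.mem_filter.2 ⟨he, rfl⟩)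
  have hrow : row (v, w) = row (v', w') := hinj _ (Finset.mem_image_of_mem _ he) _
    (Finset.mem_image_of_mem _ he') _ (hE _ he) _ (hE _ he') h
  simp only [row] at hrow h
  rw [hrow] at h
  obtain rfl : w = w' := by omega
  obtain rfl : v = v' := by omega
  rfl

end Dictionary

/-! ### Reasoning about programs -/

section Machine

/-- Total correctness with a time bound: started in `s`, the program `P` halts after at most `T` time
units in a state that satisfies `Q`. -/
def Reach (W : ℕ) (D : Store) (P : Prog) (s : MachineState) (T : ℕ)
    (Q : MachineState → Prop) : Prop :=
  ∃ s' T', T' ≤ T ∧ Runs W D P s T' s' ∧ Q s'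

variable {W : ℕ} {D : Store} {s : MachineState} {Q : MachineState → Prop}

theorem Reach.mono {P : Prog} {T T' : ℕ} {Q' : MachineState → Prop} (h : Reach W D P s T Q)
    (hT : T ≤ T') (hQ : ∀ s', Q s' → Q' s') : Reach W D P s T' Q' := by
  obtain ⟨s', T₀, h1, h2, h3⟩ := h
  exact ⟨s', T₀, h1.trans hT, h2, hQ _ h3⟩

theorem Reach.seq {p q : Prog} {T₁ T₂ : ℕ} {Q' : MachineState → Prop} (h : Reach W D p s T₁ Q')
    (h' : ∀ s', Q' s' → Reach W D q s' T₂ Q) : Reach W D (.seq p q) s (T₁ + T₂) Q := by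
  obtain ⟨s', T, h1, h2, h3⟩ := h
  obtain ⟨s'', T', h4, h5, h6⟩ := h' s' h3
  exact ⟨s'', T + T', by omega, .seq h2 h5, h6⟩

theorem Reach.ifLt {a b : ℕ} {p q : Prog} {T : ℕ} (h : s.reg a < s.reg b → Reach W D p s T Q)
    (h' : ¬ s.reg a < s.reg b → Reach W D q s T Q) : Reach W D (.ifLt a b p q) s (T + 1) Q := by
  by_cases hab : s.reg a < s.reg b
  · obtain ⟨s', T', h1, h2, h3⟩ := h hab
    exact ⟨s', T' + 1, by omega, .ifTrue hab h2, h3⟩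
  · obtain ⟨s', T', h1, h2, h3⟩ := h' hab
    exact ⟨s', T' + 1, by omega, .ifFalse hab h2, h3⟩

theorem Reach.while_done {a b : ℕ} {p : Prog} (h : ¬ s.reg a < s.reg b) (hQ : Q s) :
    Reach W D (.whileLt a b p) s 1 Q :=
  ⟨s, 1, le_rfl, .whileDone h, hQ⟩

theorem Reach.while_step {a b : ℕ} {p : Prog} {T₁ T₂ : ℕ} {Q' : MachineState → Prop}
    (hab : s.reg a < s.reg b) (h : Reach W D p s T₁ Q')
    (h' : ∀ s', Q' s' → Reach W D (.whileLt a b p) s' T₂ Q) :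
    Reach W D (.whileLt a b p) s (T₁ + T₂ + 1) Q := by
  obtain ⟨s', T, h1, h2, h3⟩ := h
  obtain ⟨s'', T', h4, h5, h6⟩ := h' s' h3
  exact ⟨s'', T + T' + 1, by omega, .whileStep hab h2 h5, h6⟩

/-- `s'` arises from `s` by writing the value `x` into the integer register `r`; the registers from `20`
on are scratch registers and may have changed as well. -/
structure Sets (s s' : MachineState) (r x : ℕ) : Prop where
  reg_self : s'.reg r = x
  reg_of_ne : ∀ y < 20, y ≠ r → s'.reg y = s.reg y
  dreg_eq : s'.dreg = s.dreg
  out_eq : s'.out = s.out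

theorem reach_const {r k : ℕ} (hk : k < 2 ^ W) :
    Reach W D (.instr (.const r k)) s 1 fun s' =>
      s' = { s with reg := Function.update s.reg r k } :=
  ⟨_, 1, le_rfl, .instr _ _, by simp [Instr.exec, Nat.mod_eq_of_lt hk]⟩

theorem reach_arith {op : WordOp} {r a b : ℕ} (h : op.eval (s.reg a) (s.reg b) < 2 ^ W) :
    Reach W D (.instr (.arith op r a b)) s 1 fun s' =>
      s' = { s with reg := Function.update s.reg r (op.eval (s.reg a) (s.reg b)) } :=
  ⟨_, 1, le_rfl, .instr _ _, by simp [Instr.exec, Nat.mod_eq_of_lt h]⟩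

theorem reach_load {r a : ℕ} :
    Reach W D (.instr (.load r a)) s 1 fun s' =>
      s' = { s with reg := Function.update s.reg r (D.words.getD (s.reg a) 0) } :=
  ⟨_, 1, le_rfl, .instr _ _, by simp [Instr.exec]⟩

theorem reach_loadDist {r a : ℕ} :
    Reach W D (.instr (.loadDist r a)) s 1 fun s' =>
      s' = { s with dreg := Function.update s.dreg r (D.dists.getD (s.reg a) 0) } :=
  ⟨_, 1, le_rfl, .instr _ _, by simp [Instr.exec]⟩

theorem reach_addDist {r a b : ℕ} :
    Reach W D (.instr (.addDist r a b)) s 1 fun s' =>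
      s' = { s with dreg := Function.update s.dreg r (s.dreg a + s.dreg b) } :=
  ⟨_, 1, le_rfl, .instr _ _, by simp [Instr.exec]⟩

theorem reach_write {a r : ℕ} :
    Reach W D (.instr (.write a r)) s 1 fun s' =>
      s' = { s with out := Function.update s.out (s.reg a) (s.reg r) } :=
  ⟨_, 1, le_rfl, .instr _ _, by simp [Instr.exec]⟩

theorem Sets.of_update {r x : ℕ} :
    Sets s { s with reg := Function.update s.reg r x } r x :=
  ⟨by simp, fun y _ hy => by simp [hy], rfl, rfl⟩

theorem reach_arith_sets {op : WordOp} {r a b x : ℕ} (hx : op.eval (s.reg a) (s.reg b) = x)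
    (h : x < 2 ^ W) : Reach W D (.instr (.arith op r a b)) s 1 fun s' => Sets s s' r x := by
  subst hx
  exact (reach_arith h).mono le_rfl fun _ hs' => hs' ▸ Sets.of_update

theorem reach_const_sets {r k : ℕ} (h : k < 2 ^ W) :
    Reach W D (.instr (.const r k)) s 1 fun s' => Sets s s' r k :=
  (reach_const h).mono le_rfl fun _ hs' => hs' ▸ Sets.of_update

/-! ### The layout of the stored data

The integer words are eight interleaved tables: the entry `idx` of the table `tag` is the word number
`8 * idx + tag`. -/

/-- The tables of the oracle for vertices named `0, …, n - 1`, each of them with `L` entries. Table `0`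
holds `n`, table `1` the level at which the queries for a vertex start, the tables `2` and `3` the
column and row displacements of the dictionary, table `4` its keys, table `5` the next hops and
table `6` the pivots, the pivot of `u` at the level `i` being stored in the entry `i * n + u`. -/
structure Layout (W : ℕ) (D : Store) (n t L : ℕ) (tab : ℕ → ℕ → ℕ) : Prop where
  words_eq : D.words = (List.range (8 * L)).map fun a => tab (a % 8) (a / 8)
  size_lt : 8 * L < 2 ^ W
  n_le : n ≤ L
  tn_le : t * n ≤ L
  nn_lt : n * n < 2 ^ W
  zero_entry : tab 0 0 = n
  lev_lt : ∀ v < n, tab 1 v < t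
  row_lt : ∀ v < n, ∀ w < n, v + tab 2 w < L
  loc_lt : ∀ v < n, ∀ w < n, tab 3 (v + tab 2 w) + w < L
  key_le : ∀ k < L, tab 4 k ≤ n * n
  pivot_lt : ∀ i < t, ∀ u < n, tab 6 (i * n + u) < n

/-- The cell of the dictionary in which the entry for the pair `(v, w)` is stored, if there is one. -/
def cell (tab : ℕ → ℕ → ℕ) (v w : ℕ) : ℕ := tab 3 (v + tab 2 w) + w

/-- `reg r := tab tag (reg idx)` -/
def fetch (r tag idx : ℕ) : Prog :=
  .seq (.instr (.const 20 8)) <| .seq (.instr (.arith .mul 20 20 idx)) <|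
  .seq (.instr (.const 21 tag)) <| .seq (.instr (.arith .add 20 20 21)) <| .instr (.load r 20)

/-- `reg r := cell tab (reg v) (reg w)` -/
def locate (r v w : ℕ) : Prog :=
  .seq (fetch 22 2 w) <| .seq (.instr (.arith .add 22 v 22)) <| .seq (fetch 23 3 22) <|
  .instr (.arith .add r 23 w)

variable {n t L : ℕ} {tab : ℕ → ℕ → ℕ}

theorem reach_fetch (hD : Layout W D n t L tab) {r tag idx : ℕ} (htag : tag < 8)
    (hidx : s.reg idx < L) (h20 : idx ≠ 20) :
    Reach W D (fetch r tag idx) s 5 fun s' => s'.reg r = tab tag (s.reg idx) ∧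
      (∀ y, y ≠ r → y ≠ 20 → y ≠ 21 → s'.reg y = s.reg y) ∧ s'.dreg = s.dreg ∧ s'.out = s.out := by
  have hsz := hD.size_lt
  have h8 : 8 < 2 ^ W := by omega
  have htagW : tag < 2 ^ W := by omega
  refine (reach_const h8).seq (T₂ := 4) ?_
  rintro _ rfl
  refine (reach_arith (op := .mul) ?_).seq (T₂ := 3) ?_
  · simp only [WordOp.eval, Function.update_self, Function.update_of_ne h20]
    omega
  rintro _ rfl
  refine (reach_const htagW).seq (T₂ := 2) ?_
  rintro _ rfl
  refine (reach_arith (op := .add) ?_).seq (T₂ := 1) ?_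
  · simp [WordOp.eval, h20]
    omega
  rintro _ rfl
  refine reach_load.mono le_rfl ?_
  rintro _ rfl
  refine ⟨?_, fun y h1 h2 h3 => by simp [h1, h2, h3], rfl, rfl⟩
  have : 8 * s.reg idx + tag < 8 * L := by omega
  simp [WordOp.eval, h20, hD.words_eq, List.getD_eq_getElem?_getD, this]
  congr 1 <;> omega

theorem reach_fetch_sets (hD : Layout W D n t L tab) {r tag idx : ℕ} (htag : tag < 8)
    (hidx : s.reg idx < L) (h20 : idx ≠ 20) :
    Reach W D (fetch r tag idx) s 5 fun s' => Sets s s' r (tab tag (s.reg idx)) :=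
  (reach_fetch hD htag hidx h20).mono le_rfl fun _ ⟨h1, h2, h3, h4⟩ =>
    ⟨h1, fun y hy hyr => h2 y hyr (by omega) (by omega), h3, h4⟩

theorem reach_locate (hD : Layout W D n t L tab) {r v w : ℕ} (hv : v < 20) (hw : w < 20)
    (hvn : s.reg v < n) (hwn : s.reg w < n) :
    Reach W D (locate r v w) s 12 fun s' => Sets s s' r (cell tab (s.reg v) (s.reg w)) := by
  have hsz := hD.size_lt
  have hn := hD.n_le
  have hrow := hD.row_lt _ hvn _ hwn
  have hloc := hD.loc_lt _ hvn _ hwn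
  refine (reach_fetch hD (by norm_num) (by omega) (by omega)).seq (T₂ := 7) ?_
  rintro s₁ ⟨h1, h1', h1d, h1o⟩
  have e1v := h1' v (by omega) (by omega) (by omega)
  have e1w := h1' w (by omega) (by omega) (by omega)
  refine (reach_arith (op := .add) ?_).seq (T₂ := 6) ?_
  · simp only [WordOp.eval, h1, e1v]; omega
  rintro s₂ rfl
  refine (reach_fetch hD (by norm_num) ?_ (by omega)).seq (T₂ := 1) ?_
  · simp only [WordOp.eval, Function.update_self, h1, e1v]; omega
  rintro s₃ ⟨h3, h3', h3d, h3o⟩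
  have e3w := h3' w (by omega) (by omega) (by omega)
  simp only [WordOp.eval, Function.update_self, h1, e1v] at h3
  simp only [Function.update_of_ne (show w ≠ 22 by omega), e1w] at e3w
  refine (reach_arith (op := .add) ?_).mono le_rfl ?_
  · simp only [WordOp.eval, h3, e3w]; omega
  rintro s₄ rfl
  refine ⟨by simp [WordOp.eval, h3, e3w, cell], fun y hy hyr => ?_, by simp [h3d, h1d],
    by simp [h3o, h1o]⟩
  simp only [Function.update_of_ne hyr, h3' y (by omega) (by omega) (by omega),
    Function.update_of_ne (show y ≠ 22 by omega), h1' y (by omega) (by omega) (by omega)]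

/-- `reg r := reg a`, provided that `reg 2 = 0`. -/
def copy (r a : ℕ) : Prog := .instr (.arith .add r a 2)

theorem reach_copy {r a : ℕ} (h2 : s.reg 2 = 0) (ha : s.reg a < 2 ^ W) :
    Reach W D (copy r a) s 1 fun s' => Sets s s' r (s.reg a) :=
  reach_arith_sets (by simp [WordOp.eval, h2]) ha

/-- `reg 7 := |reg a - reg b|`, as a sum of two truncated differences. -/
def absDiff (a b : ℕ) : Prog :=
  .seq (.instr (.arith .sub 26 a b)) <| .seq (.instr (.arith .sub 27 b a)) <|
  .instr (.arith .add 7 26 27)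

theorem reach_absDiff {a b : ℕ} (ha : a < 26) (hb : b < 26) (haW : s.reg a < 2 ^ W)
    (hbW : s.reg b < 2 ^ W) :
    Reach W D (absDiff a b) s 3 fun s' =>
      Sets s s' 7 ((s.reg a - s.reg b) + (s.reg b - s.reg a)) := by
  refine (reach_arith (op := .sub) ?_).seq (T₂ := 2) ?_
  · simp only [WordOp.eval]; omega
  rintro _ rfl
  have a26 : a ≠ 26 := by omega
  have b26 : b ≠ 26 := by omega
  refine (reach_arith (op := .sub) ?_).seq (T₂ := 1) ?_
  · simp only [WordOp.eval, Function.update_of_ne a26, Function.update_of_ne b26]; omega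
  rintro _ rfl
  refine (reach_arith (op := .add) ?_).mono le_rfl ?_
  · simp [WordOp.eval, a26, b26]; omega
  rintro _ rfl
  refine ⟨by simp [WordOp.eval, a26, b26], fun y hy hy7 => ?_, rfl, rfl⟩
  simp [hy7, show y ≠ 26 by omega, show y ≠ 27 by omega]

/-! ### The search for a common vertex of the two bunches -/

/-- `reg 6` becomes the pivot of `reg 3` at the level `reg 5`. Then `reg 7` becomes zero if and only if
the dictionary has an entry for `(reg 4, reg 6)`. -/
def probe : Prog :=
  .seq (.instr (.arith .mul 24 5 10)) <| .seq (.instr (.arith .add 24 24 3)) <|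
  .seq (fetch 6 6 24) <| .seq (locate 8 4 6) <|
  .seq (.instr (.arith .mul 24 4 10)) <| .seq (.instr (.arith .add 24 24 6)) <|
  .seq (fetch 25 4 8) <| absDiff 24 25

/-- The registers during the search, for a query about `a` and `b`: the current level is `i`, and it is
the pivot of `u` whose membership in the bunch of `v` is tested. -/
structure SearchState (n a b i u v : ℕ) (s : MachineState) : Prop where
  reg0 : s.reg 0 = a
  reg1 : s.reg 1 = b
  reg2 : s.reg 2 = 0
  reg3 : s.reg 3 = u
  reg4 : s.reg 4 = v
  reg5 : s.reg 5 = i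
  reg9 : s.reg 9 = 1
  reg10 : s.reg 10 = n

theorem SearchState.frame {a b i u v : ℕ} {s' : MachineState} (h : SearchState n a b i u v s)
    (hs : ∀ y < 20, y ≠ 6 → y ≠ 7 → y ≠ 8 → s'.reg y = s.reg y) :
    SearchState n a b i u v s' := by
  constructor
  · rw [hs] <;> first | exact h.reg0 | norm_num
  · rw [hs] <;> first | exact h.reg1 | norm_num
  · rw [hs] <;> first | exact h.reg2 | norm_num
  · rw [hs] <;> first | exact h.reg3 | norm_num
  · rw [hs] <;> first | exact h.reg4 | norm_num
  · rw [hs] <;> first | exact h.reg5 | norm_num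
  · rw [hs] <;> first | exact h.reg9 | norm_num
  · rw [hs] <;> first | exact h.reg10 | norm_num

/-- The dictionary has an entry for the pair `(v, w)`. -/
def HasEntry (n : ℕ) (tab : ℕ → ℕ → ℕ) (v w : ℕ) : Prop := tab 4 (cell tab v w) = v * n + w

theorem mul_add_lt_mul {v n w m : ℕ} (hv : v < m) (hw : w < n) : v * n + w < m * n := by
  have : (v + 1) * n ≤ m * n := Nat.mul_le_mul_right n hv
  rw [add_mul, one_mul] at this
  omega

theorem reach_probe (hD : Layout W D n t L tab) {a b i u v : ℕ} (hs : SearchState n a b i u v s)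
    (hi : i < t) (hu : u < n) (hv : v < n) :
    Reach W D probe s 29 fun s' => SearchState n a b i u v s' ∧ s'.reg 6 = tab 6 (i * n + u) ∧
      (s'.reg 7 = 0 ↔ HasEntry n tab v (tab 6 (i * n + u))) := by
  have hsz := hD.size_lt
  have hnn := hD.nn_lt
  have htn := hD.tn_le
  have hw := hD.pivot_lt i hi u hu
  have hiu : i * n + u < t * n := mul_add_lt_mul hi hu
  have hloc : cell tab v (tab 6 (i * n + u)) < L := hD.loc_lt v hv _ hw
  have hkey := hD.key_le _ hloc
  have hvw := mul_add_lt_mul hv hw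
  set w := tab 6 (i * n + u) with hwdef
  refine (reach_arith (op := .mul) ?_).seq (T₂ := 28) ?_
  · simp only [WordOp.eval, hs.reg5, hs.reg10]; omega
  rintro _ rfl
  refine (reach_arith (op := .add) ?_).seq (T₂ := 27) ?_
  · simp [WordOp.eval, hs.reg3, hs.reg5, hs.reg10]; omega
  rintro _ rfl
  refine (reach_fetch_sets hD (by norm_num) ?_ (by norm_num)).seq (T₂ := 22) ?_
  · simp [WordOp.eval, hs.reg3, hs.reg5, hs.reg10]; omega
  intro s₁ h₁
  have h1w : s₁.reg 6 = w := by
    rw [h₁.reg_self]; simp [WordOp.eval, hs.reg3, hs.reg5, hs.reg10, hwdef]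
  have h1f : ∀ y < 20, y ≠ 6 → s₁.reg y = s.reg y := fun y hy hy6 => by
    rw [h₁.reg_of_ne y hy hy6]; simp [show y ≠ 24 by omega]
  have hs₁ : SearchState n a b i u v s₁ := hs.frame fun y hy h6 _ _ => h1f y hy h6
  refine (reach_locate hD (by norm_num) (by norm_num) (by rw [hs₁.reg4]; exact hv)
    (by rw [h1w]; exact hw)).seq (T₂ := 10) ?_
  intro s₂ h₂
  have h2w : s₂.reg 6 = w := by rw [h₂.reg_of_ne] <;> first | exact h1w | norm_num
  have h2c : s₂.reg 8 = cell tab v w := by rw [h₂.reg_self, hs₁.reg4, h1w]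
  have hs₂ : SearchState n a b i u v s₂ := hs₁.frame fun y hy _ _ h8 => h₂.reg_of_ne y hy h8
  refine (reach_arith (op := .mul) ?_).seq (T₂ := 9) ?_
  · simp only [WordOp.eval, hs₂.reg4, hs₂.reg10]; omega
  rintro _ rfl
  refine (reach_arith (op := .add) ?_).seq (T₂ := 8) ?_
  · simp [WordOp.eval, hs₂.reg4, hs₂.reg10, h2w]; omega
  rintro _ rfl
  refine (reach_fetch hD (by norm_num) ?_ (by norm_num)).seq (T₂ := 3) ?_
  · simpa [h2c] using hloc
  rintro s₃ ⟨h3, h3f, -, -⟩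
  have h3k : s₃.reg 25 = tab 4 (cell tab v w) := by rw [h3]; simp [h2c]
  have h3v : s₃.reg 24 = v * n + w := by
    rw [h3f] <;> simp [WordOp.eval, hs₂.reg4, hs₂.reg10, h2w]
  refine (reach_absDiff (by norm_num) (by norm_num) (by omega) (by omega)).mono le_rfl ?_
  intro s₄ h₄
  have h4f : ∀ y < 20, y ≠ 7 → s₄.reg y = s₂.reg y := fun y hy hy7 => by
    rw [h₄.reg_of_ne y hy hy7, h3f y (by omega) (by omega) (by omega)]
    simp [show y ≠ 24 by omega]
  refine ⟨hs₂.frame fun y hy _ h7 _ => h4f y hy h7, by rw [h4f] <;> simp [h2w], ?_⟩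
  rw [h₄.reg_self, h3k, h3v, HasEntry]
  omega

/-- As long as the pivot of `reg 3` is not in the bunch of `reg 4`, exchange the two vertices and move
on to the next level. -/
def searchLoop : Prog :=
  .whileLt 2 7 <|
  .seq (copy 13 3) <| .seq (copy 3 4) <| .seq (copy 4 13) <| .seq (.instr (.arith .add 5 5 9)) probe

theorem reach_searchLoop (hD : Layout W D n t L tab) {I : ℕ → ℕ → ℕ → Prop} {a b : ℕ}
    (hI : ∀ i u v, I i u v → i < t ∧ u < n ∧ v < n)
    (hstep : ∀ i u v, I i u v → ¬ HasEntry n tab v (tab 6 (i * n + u)) → I (i + 1) v u) (m : ℕ) :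
    ∀ (i u v : ℕ) (s : MachineState), i + m = t → I i u v → SearchState n a b i u v s →
      s.reg 6 = tab 6 (i * n + u) → (s.reg 7 = 0 ↔ HasEntry n tab v (tab 6 (i * n + u))) →
      Reach W D searchLoop s (34 * m + 1) fun s' => ∃ i u v, I i u v ∧ SearchState n a b i u v s' ∧
        s'.reg 6 = tab 6 (i * n + u) ∧ HasEntry n tab v (tab 6 (i * n + u)) := by
  have hsz := hD.size_lt
  have hn := hD.n_le
  have htn := hD.tn_le
  induction m with
  | zero =>
    intro i u v s hi h
    exact absurd (hI i u v h).1 (by omega)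
  | succ m ih =>
    intro i u v s hi h hs h6 h7
    obtain ⟨hit, hu, hv⟩ := hI i u v h
    by_cases hent : HasEntry n tab v (tab 6 (i * n + u))
    · refine (Reach.while_done ?_ ⟨i, u, v, h, hs, h6, hent⟩).mono (by omega) fun _ h => h
      rw [h7.2 hent]; omega
    have h' := hstep i u v h hent
    have hit' := (hI _ _ _ h').1
    have htW : t < 2 ^ W := by
      have : t * 1 ≤ t * n := Nat.mul_le_mul_left t (by omega)
      omega
    refine (Reach.while_step (T₁ := 33) (T₂ := 34 * m + 1)
      (Q' := fun s' => SearchState n a b (i + 1) v u s' ∧ s'.reg 6 = tab 6 ((i + 1) * n + v) ∧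
        (s'.reg 7 = 0 ↔ HasEntry n tab u (tab 6 ((i + 1) * n + v)))) ?_ ?_ ?_).mono (by omega)
        fun _ h => h
    · rw [hs.reg2]
      exact Nat.pos_of_ne_zero fun h0 => hent (h7.1 h0)
    · refine (reach_copy hs.reg2 (by rw [hs.reg3]; omega)).seq (T₂ := 32) ?_
      intro s₁ h₁
      have f1 := h₁.reg_of_ne
      refine (reach_copy (by rw [f1] <;> first | exact hs.reg2 | norm_num)
        (by rw [f1 4 (by norm_num) (by norm_num), hs.reg4]; omega)).seq (T₂ := 31) ?_
      intro s₂ h₂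
      have f2 : ∀ y < 20, y ≠ 13 → y ≠ 3 → s₂.reg y = s.reg y := fun y hy h13 h3 => by
        rw [h₂.reg_of_ne y hy h3, f1 y hy h13]
      have e13 : s₂.reg 13 = u := by
        rw [h₂.reg_of_ne 13 (by norm_num) (by norm_num), h₁.reg_self, hs.reg3]
      have e3 : s₂.reg 3 = v := by rw [h₂.reg_self, f1 4 (by norm_num) (by norm_num), hs.reg4]
      refine (reach_copy (by rw [f2] <;> first | exact hs.reg2 | norm_num)
        (by rw [e13]; omega)).seq (T₂ := 30) ?_
      intro s₃ h₃
      have f3 : ∀ y < 20, y ≠ 13 → y ≠ 3 → y ≠ 4 → s₃.reg y = s.reg y := fun y hy h13 h3 h4 => by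
        rw [h₃.reg_of_ne y hy h4, f2 y hy h13 h3]
      refine (reach_arith_sets (x := i + 1) ?_ (by omega)).seq (T₂ := 29) ?_
      · simp [WordOp.eval, f3 5, f3 9, hs.reg5, hs.reg9]
      intro s₄ h₄
      refine reach_probe hD ?_ hit' hv hu
      have f4 : ∀ y < 20, y ≠ 13 → y ≠ 3 → y ≠ 4 → y ≠ 5 → s₄.reg y = s.reg y :=
        fun y hy h13 h3 h4 h5 => by rw [h₄.reg_of_ne y hy h5, f3 y hy h13 h3 h4]
      constructor
      · simp [f4, hs.reg0]
      · simp [f4, hs.reg1]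
      · simp [f4, hs.reg2]
      · rw [h₄.reg_of_ne 3 (by norm_num) (by norm_num), h₃.reg_of_ne 3 (by norm_num) (by norm_num),
          e3]
      · rw [h₄.reg_of_ne 4 (by norm_num) (by norm_num), h₃.reg_self, e13]
      · exact h₄.reg_self
      · simp [f4, hs.reg9]
      · simp [f4, hs.reg10]
    · rintro s' ⟨h1, h2, h3⟩
      exact ih (i + 1) v u s' (by omega) h' h1 h2 h3

/-- The search starts with `u` being the queried vertex of higher level, at its level. -/
def search : Prog :=
  .seq (fetch 10 0 2) <| .seq (fetch 11 1 0) <| .seq (fetch 12 1 1) <| .seq (.instr (.const 9 1)) <|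
  .seq (.ifLt 11 12 (.seq (copy 3 1) <| .seq (copy 4 0) (copy 5 12))
    (.seq (copy 3 0) <| .seq (copy 4 1) (copy 5 11))) <|
  .seq probe searchLoop

theorem reach_search_init (hD : Layout W D n t L tab) {a b x y z i : ℕ} (hy : y < 20)
    (hz : z < 20) (hy3 : y ≠ 3) (hz3 : z ≠ 3) (hz4 : z ≠ 4) (h0 : s.reg 0 = a) (h1 : s.reg 1 = b)
    (h2 : s.reg 2 = 0) (h9 : s.reg 9 = 1) (h10 : s.reg 10 = n) (hxn : s.reg x < n)
    (hyn : s.reg y < n) (hzi : s.reg z = i) (hi : i < 2 ^ W) :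
    Reach W D (.seq (copy 3 x) <| .seq (copy 4 y) (copy 5 z)) s 3
      (SearchState n a b i (s.reg x) (s.reg y)) := by
  have hsz := hD.size_lt
  have hn := hD.n_le
  refine (reach_copy h2 (by omega)).seq (T₂ := 2) ?_
  intro s₁ h₁
  refine (reach_copy (by rw [h₁.reg_of_ne 2 (by norm_num) (by norm_num), h2])
    (by rw [h₁.reg_of_ne y hy hy3]; omega)).seq (T₂ := 1) ?_
  intro s₂ h₂
  have e2z : s₂.reg z = i := by rw [h₂.reg_of_ne z hz hz4, h₁.reg_of_ne z hz hz3, hzi]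
  refine (reach_copy (by rw [h₂.reg_of_ne 2 (by norm_num) (by norm_num),
    h₁.reg_of_ne 2 (by norm_num) (by norm_num), h2]) (by rw [e2z]; exact hi)).mono le_rfl ?_
  intro s₃ h₃
  have f3 : ∀ y < 20, y ≠ 3 → y ≠ 4 → y ≠ 5 → s₃.reg y = s.reg y :=
    fun y hy h3 h4 h5 => by rw [h₃.reg_of_ne y hy h5, h₂.reg_of_ne y hy h4, h₁.reg_of_ne y hy h3]
  constructor
  · simp [f3, h0]
  · simp [f3, h1]
  · simp [f3, h2]
  · rw [h₃.reg_of_ne 3 (by norm_num) (by norm_num), h₂.reg_of_ne 3 (by norm_num) (by norm_num),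
      h₁.reg_self]
  · rw [h₃.reg_of_ne 4 (by norm_num) (by norm_num), h₂.reg_self, h₁.reg_of_ne y hy hy3]
  · rw [h₃.reg_self, e2z]
  · simp [f3, h9]
  · simp [f3, h10]

theorem reach_search (hD : Layout W D n t L tab) {I : ℕ → ℕ → ℕ → Prop} {a b : ℕ} (ha : a < n)
    (hb : b < n) (hI : ∀ i u v, I i u v → i < t ∧ u < n ∧ v < n)
    (hstep : ∀ i u v, I i u v → ¬ HasEntry n tab v (tab 6 (i * n + u)) → I (i + 1) v u)
    (hinit₁ : tab 1 a < tab 1 b → I (tab 1 b) b a) (hinit₂ : ¬ tab 1 a < tab 1 b → I (tab 1 a) a b) :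
    Reach W D search (queryState a b) (34 * (t - max (tab 1 a) (tab 1 b)) + 50) fun s' =>
      ∃ i u v, I i u v ∧ SearchState n a b i u v s' ∧
        s'.reg 6 = tab 6 (i * n + u) ∧ HasEntry n tab v (tab 6 (i * n + u)) := by
  have hsz := hD.size_lt
  have hn := hD.n_le
  have htn := hD.tn_le
  have hla := hD.lev_lt a ha
  have hlb := hD.lev_lt b hb
  have htW : t < 2 ^ W := by
    have : t * 1 ≤ t * n := Nat.mul_le_mul_left t (by omega)
    omega
  set lv := max (tab 1 a) (tab 1 b) with hlv
  have q0 : (queryState a b).reg 0 = a := by simp [queryState]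
  have q1 : (queryState a b).reg 1 = b := by simp [queryState]
  have q2 : (queryState a b).reg 2 = 0 := by simp [queryState]
  refine Reach.mono (T := 5 + (5 + (5 + (1 + (4 + (29 + (34 * (t - lv) + 1)))))))
    (Q := fun s' => ∃ i u v, I i u v ∧ SearchState n a b i u v s' ∧
        s'.reg 6 = tab 6 (i * n + u) ∧ HasEntry n tab v (tab 6 (i * n + u))) ?_ (by omega)
        fun _ h => h
  refine (reach_fetch_sets hD (by norm_num) (by rw [q2]; omega) (by norm_num)).seq ?_
  intro s₁ h₁
  rw [q2, hD.zero_entry] at h₁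
  refine (reach_fetch_sets hD (by norm_num) (by
    rw [h₁.reg_of_ne 0 (by norm_num) (by norm_num), q0]; omega) (by norm_num)).seq ?_
  intro s₂ h₂
  rw [h₁.reg_of_ne 0 (by norm_num) (by norm_num), q0] at h₂
  refine (reach_fetch_sets hD (by norm_num) (by
    rw [h₂.reg_of_ne 1 (by norm_num) (by norm_num), h₁.reg_of_ne 1 (by norm_num) (by norm_num), q1]
    omega) (by norm_num)).seq ?_
  intro s₃ h₃
  rw [h₂.reg_of_ne 1 (by norm_num) (by norm_num), h₁.reg_of_ne 1 (by norm_num) (by norm_num), q1]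
    at h₃
  refine (reach_const_sets (by omega)).seq ?_
  intro s₄ h₄
  have f4 : ∀ y < 20, y ≠ 9 → y ≠ 10 → y ≠ 11 → y ≠ 12 → s₄.reg y = (queryState a b).reg y :=
    fun y hy h9 h10 h11 h12 => by
      rw [h₄.reg_of_ne y hy h9, h₃.reg_of_ne y hy h12, h₂.reg_of_ne y hy h11,
        h₁.reg_of_ne y hy h10]
  have e0 : s₄.reg 0 = a := by simp [f4, q0]
  have e1 : s₄.reg 1 = b := by simp [f4, q1]
  have e2 : s₄.reg 2 = 0 := by simp [f4, q2]
  have e9 : s₄.reg 9 = 1 := h₄.reg_self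
  have e10 : s₄.reg 10 = n := by
    rw [h₄.reg_of_ne 10 (by norm_num) (by norm_num), h₃.reg_of_ne 10 (by norm_num) (by norm_num),
      h₂.reg_of_ne 10 (by norm_num) (by norm_num), h₁.reg_self]
  have e11 : s₄.reg 11 = tab 1 a := by
    rw [h₄.reg_of_ne 11 (by norm_num) (by norm_num), h₃.reg_of_ne 11 (by norm_num) (by norm_num),
      h₂.reg_self]
  have e12 : s₄.reg 12 = tab 1 b := by
    rw [h₄.reg_of_ne 12 (by norm_num) (by norm_num), h₃.reg_self]
  refine Reach.seq (Q' := fun s' => ∃ u v, I lv u v ∧ SearchState n a b lv u v s')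
    (Reach.ifLt (T := 3) (fun hlt => ?_) fun hlt => ?_) ?_
  · rw [e11, e12] at hlt
    have hlv' : lv = tab 1 b := max_eq_right hlt.le
    refine (reach_search_init hD (x := 1) (y := 0) (z := 12) (i := lv) (by norm_num) (by norm_num)
      (by norm_num) (by norm_num) (by norm_num) e0 e1 e2 e9 e10 (by omega) (by omega)
      (by omega) (by omega)).mono le_rfl fun s' hs' => ⟨b, a, hlv' ▸ hinit₁ hlt, ?_⟩
    rwa [e0, e1] at hs'
  · rw [e11, e12] at hlt
    have hlv' : lv = tab 1 a := max_eq_left (not_lt.1 hlt)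
    refine (reach_search_init hD (x := 0) (y := 1) (z := 11) (i := lv) (by norm_num) (by norm_num)
      (by norm_num) (by norm_num) (by norm_num) e0 e1 e2 e9 e10 (by omega) (by omega)
      (by omega) (by omega)).mono le_rfl fun s' hs' => ⟨a, b, hlv' ▸ hinit₂ hlt, ?_⟩
    rwa [e0, e1] at hs'
  rintro s₅ ⟨u, v, hIuv, hs₅⟩
  obtain ⟨hlvt, hu, hv⟩ := hI _ _ _ hIuv
  refine (reach_probe hD hs₅ hlvt hu hv).seq ?_
  rintro s₆ ⟨h6, h6', h6''⟩
  exact reach_searchLoop hD hI hstep (t - lv) lv u v s₆ (by omega) hIuv h6 h6' h6''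

/-! ### The two query programs -/

/-- The distance query: the sum of the stored distances of the two vertices to the vertex that the
search has found. -/
def distanceQuery : Prog :=
  .seq search <| .seq (locate 8 0 6) <| .seq (.instr (.loadDist 0 8)) <| .seq (locate 8 1 6) <|
  .seq (.instr (.loadDist 1 8)) (.instr (.addDist 0 0 1))

theorem reach_distanceQuery_tail (hD : Layout W D n t L tab) {a b i u v w : ℕ} (ha : a < n)
    (hb : b < n) (hw : w < n) (hs : SearchState n a b i u v s) (h6 : s.reg 6 = w) :
    Reach W D (.seq (locate 8 0 6) <| .seq (.instr (.loadDist 0 8)) <| .seq (locate 8 1 6) <|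
        .seq (.instr (.loadDist 1 8)) (.instr (.addDist 0 0 1))) s 27 fun s' =>
      s'.dreg 0 = D.dists.getD (cell tab a w) 0 + D.dists.getD (cell tab b w) 0 := by
  refine (reach_locate hD (by norm_num) (by norm_num) (by rw [hs.reg0]; exact ha)
    (by rw [h6]; exact hw)).seq (T₂ := 15) ?_
  intro s₁ h₁
  refine reach_loadDist.seq (T₂ := 14) ?_
  rintro _ rfl
  have e1 : s₁.reg 1 = b := by rw [h₁.reg_of_ne 1 (by norm_num) (by norm_num), hs.reg1]
  have e6 : s₁.reg 6 = w := by rw [h₁.reg_of_ne 6 (by norm_num) (by norm_num), h6]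
  have e8 : s₁.reg 8 = cell tab a w := by rw [h₁.reg_self, hs.reg0, h6]
  refine (reach_locate hD (by norm_num) (by norm_num) (by simpa [e1] using hb)
    (by simpa [e6] using hw)).seq (T₂ := 2) ?_
  intro s₂ h₂
  refine reach_loadDist.seq (T₂ := 1) ?_
  rintro _ rfl
  refine reach_addDist.mono le_rfl ?_
  rintro _ rfl
  have e8' : s₂.reg 8 = cell tab b w := by rw [h₂.reg_self, e1, e6]
  simp [h₂.dreg_eq, e8, e8']

/-- Follow the next hops from `reg 3` to `reg 6`. The vertices before `reg 6` are written to the output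
cells that start at `reg 15` and go up or down according to `op`. -/
def follow (op : WordOp) : Prog :=
  .seq (absDiff 3 6) <| .whileLt 2 7 <|
  .seq (.instr (.write 15 3)) <| .seq (.instr (.arith op 15 15 9)) <| .seq (locate 8 3 6) <|
  .seq (fetch 3 5 8) (absDiff 3 6)

/-- The effect of `follow` on the vertices `f 0, …, f len` and the cells `g 0, …, g len`. -/
structure Follows (f g : ℕ → ℕ) (len : ℕ) (s s' : MachineState) : Prop where
  reg15 : s'.reg 15 = g len
  reg_of_ne : ∀ y < 20, y ≠ 3 → y ≠ 7 → y ≠ 8 → y ≠ 15 → s'.reg y = s.reg y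
  out_cell : ∀ k < len, s'.out (g k) = f k
  out_of_ne : ∀ c, (∀ k < len, c ≠ g k) → s'.out c = s.out c

theorem reach_follow (hD : Layout W D n t L tab) {op : WordOp} {w : ℕ} (hw : w < n) (len : ℕ) :
    ∀ (f g : ℕ → ℕ) (s : MachineState), (∀ k ≤ len, f k < n) → f len = w → (∀ k < len, f k ≠ w) →
      (∀ k < len, tab 5 (cell tab (f k) w) = f (k + 1)) →
      (∀ k < len, op.eval (g k) 1 = g (k + 1)) → (∀ k ≤ len, g k < 2 ^ W) →
      (∀ k < len, ∀ k' < len, g k = g k' → k = k') →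
      s.reg 2 = 0 → s.reg 9 = 1 → s.reg 6 = w → s.reg 3 = f 0 → s.reg 15 = g 0 →
      Reach W D (follow op) s (23 * len + 4) (Follows f g len s) := by
  have hsz := hD.size_lt
  have hn := hD.n_le
  induction len with
  | zero =>
    intro f g s hf hlast hne hnext hg hgW hginj h2 h9 h6 h3 h15
    refine (reach_absDiff (by norm_num) (by norm_num) (by have := hf 0; omega) (by omega)).seq
      (T₂ := 1) fun s' h' => ?_
    refine Reach.while_done ?_ ⟨?_, fun y hy _ h7 _ _ => h'.reg_of_ne y hy h7, by simp, fun c _ => by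
      rw [h'.out_eq]⟩
    · rw [h'.reg_self, h'.reg_of_ne 2 (by norm_num) (by norm_num), h3, hlast, h6]; omega
    · rw [h'.reg_of_ne 15 (by norm_num) (by norm_num), h15]
  | succ len ih =>
    intro f g s hf hlast hne hnext hg hgW hginj h2 h9 h6 h3 h15
    have hf0 := hf 0 (by omega)
    have hcell : cell tab (f 0) w < L := hD.loc_lt _ hf0 _ hw
    refine Reach.mono (T := 3 + (23 * len + 24)) (Q := Follows f g (len + 1) s) ?_ (by omega)
      fun _ h => h
    refine (reach_absDiff (by norm_num) (by norm_num) (by omega) (by omega)).seq fun s₀ h₀ => ?_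
    have f0 := h₀.reg_of_ne
    -- One round without its final comparison leads to a state from which `follow` runs for the rest.
    have hround : Reach W D (.seq (.instr (.write 15 3)) <| .seq (.instr (.arith op 15 15 9)) <|
        .seq (locate 8 3 6) (fetch 3 5 8)) s₀ 19 fun s' => s'.reg 3 = f 1 ∧ s'.reg 15 = g 1 ∧
          (∀ y < 20, y ≠ 3 → y ≠ 7 → y ≠ 8 → y ≠ 15 → s'.reg y = s.reg y) ∧
          s'.out = Function.update s.out (g 0) (f 0) := by
      refine reach_write.seq (T₂ := 18) ?_
      rintro _ rfl
      refine (reach_arith_sets (x := g 1) ?_ (hgW 1 (by omega))).seq (T₂ := 17) ?_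
      · simp only [f0 15 (by norm_num) (by norm_num), f0 9 (by norm_num) (by norm_num), h15, h9]
        exact hg 0 (by omega)
      intro s₁ h₁
      have e3 : s₁.reg 3 = f 0 := by
        rw [h₁.reg_of_ne 3 (by norm_num) (by norm_num)]
        simp [f0, h3]
      have e6 : s₁.reg 6 = w := by
        rw [h₁.reg_of_ne 6 (by norm_num) (by norm_num)]
        simp [f0, h6]
      refine (reach_locate hD (by norm_num) (by norm_num) (by omega) (by omega)).seq (T₂ := 5) ?_
      intro s₂ h₂
      rw [e3, e6] at h₂
      refine (reach_fetch_sets hD (by norm_num) (by rw [h₂.reg_self]; exact hcell)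
        (by norm_num)).mono le_rfl ?_
      intro s₃ h₃
      refine ⟨?_, ?_, fun y hy y3 y7 y8 y15 => ?_, ?_⟩
      · rw [h₃.reg_self, h₂.reg_self]
        exact hnext 0 (by omega)
      · rw [h₃.reg_of_ne 15 (by norm_num) (by norm_num), h₂.reg_of_ne 15 (by norm_num) (by norm_num),
          h₁.reg_self]
      · rw [h₃.reg_of_ne y hy y3, h₂.reg_of_ne y hy y8, h₁.reg_of_ne y hy y15]
        exact f0 y hy y7
      · rw [h₃.out_eq, h₂.out_eq, h₁.out_eq]
        simp [h₀.out_eq, f0, h15, h3]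
    obtain ⟨s', T', hT', hrun, e3, e15, ef, eo⟩ := hround
    obtain ⟨s'', T'', hT'', hrun', hQ⟩ := ih (fun k => f (k + 1)) (fun k => g (k + 1)) s'
      (fun k hk => hf (k + 1) (by omega)) hlast (fun k hk => hne (k + 1) (by omega))
      (fun k hk => hnext (k + 1) (by omega)) (fun k hk => hg (k + 1) (by omega))
      (fun k hk => hgW (k + 1) (by omega))
      (fun k hk k' hk' h => Nat.succ_injective (hginj (k + 1) (by omega) (k' + 1) (by omega) h))
      (by rw [ef] <;> first | exact h2 | norm_num) (by rw [ef] <;> first | exact h9 | norm_num)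
      (by rw [ef] <;> first | exact h6 | norm_num) e3 e15
    refine ⟨s'', T' + T'' + 1, by omega, ?_, ?_, ?_, ?_, ?_⟩
    · have hlt : s₀.reg 2 < s₀.reg 7 := by
        have := hne 0 (by omega)
        rw [h₀.reg_self, f0 2 (by norm_num) (by norm_num), h2, h3, h6]
        omega
      cases hrun' with
      | seq hc hl =>
        cases hrun with
        | seq r1 hrun =>
          cases hrun with
          | seq r2 hrun =>
            cases hrun with
            | seq r3 r4 =>
              have := Runs.whileStep hlt (.seq r1 (.seq r2 (.seq r3 (.seq r4 hc)))) hl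
              convert this using 1
              omega
    · exact hQ.reg15
    · intro y hy y3 y7 y8 y15
      rw [hQ.reg_of_ne y hy y3 y7 y8 y15, ef y hy y3 y7 y8 y15]
    · rintro (_ | k) hk
      · rw [hQ.out_of_ne, eo, Function.update_self]
        intro k' hk' h
        exact absurd (hginj 0 (by omega) (k' + 1) (by omega) h) (by omega)
      · exact hQ.out_cell k (by omega)
    · intro c hc
      rw [hQ.out_of_ne c fun k hk => hc (k + 1) (by omega), eo,
        Function.update_of_ne (hc 0 (by omega))]

/-- The path query. After the search, the first `follow` writes the part of the path from the first
vertex to the common vertex. The second one starts at the second vertex and only serves to find the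
length of its part, which the third one then writes backwards. -/
def pathQuery : Prog :=
  .seq search <| .seq (.instr (.const 15 0)) <| .seq (copy 3 0) <| .seq (follow .add) <|
  .seq (copy 3 1) <| .seq (follow .add) <| .seq (copy 0 15) <| .seq (copy 3 1) <|
  .seq (follow .sub) (.instr (.write 15 6))

theorem reach_pathQuery_tail (hD : Layout W D n t L tab) {a b i u v w : ℕ} (hw : w < n)
    (hs : SearchState n a b i u v s) (h6 : s.reg 6 = w) {f f' : ℕ → ℕ} {len len' : ℕ}
    (hf : ∀ k ≤ len, f k < n) (hf' : ∀ k ≤ len', f' k < n) (hlast : f len = w)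
    (hlast' : f' len' = w) (hne : ∀ k < len, f k ≠ w) (hne' : ∀ k < len', f' k ≠ w)
    (hnext : ∀ k < len, tab 5 (cell tab (f k) w) = f (k + 1))
    (hnext' : ∀ k < len', tab 5 (cell tab (f' k) w) = f' (k + 1))
    (hlen : len + len' < 2 ^ W) (hfa : f 0 = a) (hfb : f' 0 = b) :
    Reach W D (.seq (.instr (.const 15 0)) <| .seq (copy 3 0) <| .seq (follow .add) <|
        .seq (copy 3 1) <| .seq (follow .add) <| .seq (copy 0 15) <| .seq (copy 3 1) <|
        .seq (follow .sub) (.instr (.write 15 6))) s (46 * (len + len') + 18) fun s' =>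
      s'.reg 0 = len + len' ∧ (∀ k ≤ len, s'.out k = f k) ∧
        (∀ k ≤ len', s'.out (len + len' - k) = f' k) := by
  have hsz := hD.size_lt
  have hn := hD.n_le
  have ha := hf 0 (by omega)
  have hb := hf' 0 (by omega)
  refine Reach.mono (T := 1 + (1 + ((23 * len + 4) + (1 + ((23 * len' + 4) + (1 + (1 +
    ((23 * len' + 4) + 1)))))))) (Q := fun s' =>
      s'.reg 0 = len + len' ∧ (∀ k ≤ len, s'.out k = f k) ∧
        (∀ k ≤ len', s'.out (len + len' - k) = f' k)) ?_ (by omega) fun _ h => h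
  refine (reach_const_sets (by omega)).seq fun s₁ h₁ => ?_
  have f1 : ∀ y < 20, y ≠ 3 → y ≠ 7 → y ≠ 8 → y ≠ 15 → s₁.reg y = s.reg y :=
    fun y hy _ _ _ h15 => h₁.reg_of_ne y hy h15
  refine (reach_copy (by simp [f1, hs.reg2]) (by simp [f1, hs.reg0]; omega)).seq fun s₂ h₂ => ?_
  have f2 : ∀ y < 20, y ≠ 3 → y ≠ 7 → y ≠ 8 → y ≠ 15 → s₂.reg y = s.reg y :=
    fun y hy h3 h7 h8 h15 => by rw [h₂.reg_of_ne y hy h3, f1 y hy h3 h7 h8 h15]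
  refine (reach_follow hD hw len f (fun k => k) s₂ hf hlast hne hnext (fun k _ => rfl)
    (fun k hk => by omega) (fun k _ k' _ h => h) (by simp [f2, hs.reg2]) (by simp [f2, hs.reg9])
    (by simp [f2, h6]) (by rw [h₂.reg_self]; simp [f1, hs.reg0, hfa])
    (by rw [h₂.reg_of_ne 15 (by norm_num) (by norm_num), h₁.reg_self])).seq fun s₃ h₃ => ?_
  have f3 : ∀ y < 20, y ≠ 3 → y ≠ 7 → y ≠ 8 → y ≠ 15 → s₃.reg y = s.reg y :=
    fun y hy y3 y7 y8 y15 => by rw [h₃.reg_of_ne y hy y3 y7 y8 y15, f2 y hy y3 y7 y8 y15]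
  refine (reach_copy (by simp [f3, hs.reg2]) (by simp [f3, hs.reg1]; omega)).seq fun s₄ h₄ => ?_
  have f4 : ∀ y < 20, y ≠ 3 → y ≠ 7 → y ≠ 8 → y ≠ 15 → s₄.reg y = s.reg y :=
    fun y hy h3 h7 h8 h15 => by rw [h₄.reg_of_ne y hy h3, f3 y hy h3 h7 h8 h15]
  refine (reach_follow hD hw len' f' (fun k => len + k) s₄ hf' hlast' hne' hnext' (fun k _ => rfl)
    (fun k hk => by omega) (fun k _ k' _ h => by omega) (by simp [f4, hs.reg2])
    (by simp [f4, hs.reg9]) (by simp [f4, h6]) (by rw [h₄.reg_self]; simp [f3, hs.reg1, hfb])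
    (by rw [h₄.reg_of_ne 15 (by norm_num) (by norm_num), h₃.reg15]; rfl)).seq fun s₅ h₅ => ?_
  have f5 : ∀ y < 20, y ≠ 3 → y ≠ 7 → y ≠ 8 → y ≠ 15 → s₅.reg y = s.reg y :=
    fun y hy y3 y7 y8 y15 => by rw [h₅.reg_of_ne y hy y3 y7 y8 y15, f4 y hy y3 y7 y8 y15]
  have e15 := h₅.reg15
  refine (reach_copy (by simp [f5, hs.reg2]) (by omega)).seq fun s₆ h₆ => ?_
  have f6 : ∀ y < 20, y ≠ 0 → y ≠ 3 → y ≠ 7 → y ≠ 8 → y ≠ 15 → s₆.reg y = s.reg y :=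
    fun y hy h0 h3 h7 h8 h15 => by rw [h₆.reg_of_ne y hy h0, f5 y hy h3 h7 h8 h15]
  refine (reach_copy (by simp [f6, hs.reg2]) (by simp [f6, hs.reg1]; omega)).seq fun s₇ h₇ => ?_
  have f7 : ∀ y < 20, y ≠ 0 → y ≠ 3 → y ≠ 7 → y ≠ 8 → y ≠ 15 → s₇.reg y = s.reg y :=
    fun y hy h0 h3 h7 h8 h15 => by rw [h₇.reg_of_ne y hy h3, f6 y hy h0 h3 h7 h8 h15]
  refine (reach_follow hD hw len' f' (fun k => len + len' - k) s₇ hf' hlast' hne' hnext'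
    (fun k _ => by simp only [WordOp.eval]; omega) (fun k hk => by omega)
    (fun k _ k' _ h => by omega) (by simp [f7, hs.reg2]) (by simp [f7, hs.reg9])
    (by simp [f7, h6]) (by rw [h₇.reg_self]; simp [f6, hs.reg1, hfb])
    (by rw [h₇.reg_of_ne 15 (by norm_num) (by norm_num), h₆.reg_of_ne 15 (by norm_num) (by norm_num),
      e15]; rfl)).seq fun s₈ h₈ => ?_
  have f8 : ∀ y < 20, y ≠ 0 → y ≠ 3 → y ≠ 7 → y ≠ 8 → y ≠ 15 → s₈.reg y = s.reg y :=
    fun y hy y0 y3 y7 y8 y15 => by rw [h₈.reg_of_ne y hy y3 y7 y8 y15, f7 y hy y0 y3 y7 y8 y15]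
  have g15 : s₈.reg 15 = len := by rw [h₈.reg15]; omega
  refine reach_write.mono le_rfl ?_
  rintro _ rfl
  simp only [g15, f8 6 (by norm_num) (by norm_num) (by norm_num) (by norm_num) (by norm_num)
    (by norm_num), h6]
  refine ⟨?_, fun k hk => ?_, fun k hk => ?_⟩
  · rw [h₈.reg_of_ne 0 (by norm_num) (by norm_num) (by norm_num) (by norm_num) (by norm_num),
      h₇.reg_of_ne 0 (by norm_num) (by norm_num), h₆.reg_self, e15]
  · rcases hk.eq_or_lt with rfl | hk
    · rw [Function.update_self, hlast]
    · rw [Function.update_of_ne (by omega), h₈.out_of_ne k (fun k' hk' => by omega), h₇.out_eq,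
        h₆.out_eq, h₅.out_of_ne k (fun k' _ => by omega), h₄.out_eq]
      exact h₃.out_cell k hk
  · rcases hk.eq_or_lt with rfl | hk
    · rw [Nat.add_sub_cancel, Function.update_self, hlast']
    · rw [Function.update_of_ne (by omega)]
      exact h₈.out_cell k hk

end Machine

/-! ### Bunches and pivots -/

section Bunches

variable {V : Type*}

/-- `B v w` says that `w` is in the bunch of `v`, and `P i v` is the pivot of `v` at the level `i`. The
bunches are closed under next hops, so that a path to `w` can be followed within the dictionary. If
the pivot of `u` is not in the bunch of `v`, then the pivot of `v` at the next level is not much further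
away. -/
structure BunchSystem (d : V → V → ℝ) (nx : V → V → V) (lev : V → ℕ) (t : ℕ) (B : V → V → Prop)
    (P : ℕ → V → V) : Prop where
  pivot_mem : ∀ i < t, ∀ v, B v (P i v)
  pivot_lev : ∀ v, d (P (lev v) v) v ≤ 0
  step : ∀ i < t, ∀ u v, ¬ B v (P i u) → i + 1 < t ∧ d (P (i + 1) v) v ≤ d (P i u) u + d u v
  next_mem : ∀ v w, v ≠ w → B v w → B (nx v w) w

/-- If the nearest vertex of a level is not in the bunch of `v`, then some vertex of the next level is at
most as far away, so the nearest vertex of the next level can be taken instead. -/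
theorem exists_pivot {d : V → V → ℝ} {A : ℕ → Finset V} (hA : ∀ k, A (k + 1) ⊆ A k) {t : ℕ}
    (hAt : A t = ∅) (v : V) (m : ℕ) : ∀ i, i + m = t → (A i).Nonempty →
      ∃ w ∈ A i, (∀ w' ∈ A i, d w v ≤ d w' v) ∧ ∃ k < t, w ∈ bunch d (A k) (A (k + 1)) v := by
  induction m with
  | zero =>
    intro i hi hne
    obtain rfl : i = t := hi
    simp [hAt] at hne
  | succ m ih =>
    intro i hi hne
    obtain ⟨w, hw, hmin⟩ := Finset.exists_min_image (A i) (fun w => d w v) hne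
    by_cases hb : ∀ w' ∈ A (i + 1), d w v < d w' v
    · exact ⟨w, hw, hmin, i, by omega, mem_bunch.2 ⟨hw, hb⟩⟩
    · push Not at hb
      obtain ⟨w', hw', hle⟩ := hb
      obtain ⟨w₁, hw₁, hmin₁, hB⟩ := ih (i + 1) (by omega) ⟨w', hw'⟩
      exact ⟨w₁, hA i hw₁, fun z hz => (hmin₁ w' hw').trans (hle.trans (hmin z hz)), hB⟩

theorem exists_bunchSystem [Fintype V] {G : SimpleGraph V} {wt : Sym2 V → ℝ} (hG : G.Connected)
    (hpos : ∀ e ∈ G.edgeSet, 0 < wt e) {nx : V → V → V} (hnx : IsNextHop G wt nx) {q : ℝ}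
    (hq : 1 ≤ q) {lev : V → ℕ} {t : ℕ} (ht : 1 ≤ t) (hqt : q ^ t = Fintype.card V)
    (hlev : ∀ v, lev v < t) (hS : ∀ i < t, (Nat.card {v // i ≤ lev v} : ℝ) ≤ q ^ (t - i))
    (htop : ∃ v, lev v = t - 1) :
    ∃ (B : V → V → Prop) (P : ℕ → V → V), BunchSystem (graphDist G wt) nx lev t B P ∧
      (Nat.card {e : V × V // B e.1 e.2} : ℝ) ≤ 2 * t * (Fintype.card V * q) := by
  classical
  set d := graphDist G wt with hd
  obtain ⟨A, hA, hAlev, hAt, hcost⟩ := exists_hierarchy d hq lev ht hqt hlev hS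
  obtain ⟨v₁, hv₁⟩ := htop
  have hpiv : ∀ i v, ∃ w, i < t → w ∈ A i ∧ (∀ w' ∈ A i, d w v ≤ d w' v) ∧
      ∃ k < t, w ∈ bunch d (A k) (A (k + 1)) v := fun i v => by
    by_cases hi : i < t
    · obtain ⟨w, hw⟩ := exists_pivot (d := d) hA hAt v (t - i) i (by omega)
        ⟨v₁, hAlev i v₁ (by omega)⟩
      exact ⟨w, fun _ => hw⟩
    · exact ⟨v, fun h => absurd h hi⟩
  choose P hP using hpiv
  refine ⟨fun v w => ∃ k < t, w ∈ bunch d (A k) (A (k + 1)) v, P, ⟨?_, ?_, ?_, ?_⟩, ?_⟩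
  · exact fun i hi v => (hP i v hi).2.2
  · intro v
    refine ((hP _ v (hlev v)).2.1 v (hAlev _ v le_rfl)).trans ?_
    rw [hd, graphDist_self hpos]
  · intro i hi u v hnot
    obtain ⟨hPi, -, -⟩ := hP i u hi
    have : ¬ ∀ w' ∈ A (i + 1), d (P i u) v < d w' v := fun h =>
      hnot ⟨i, hi, mem_bunch.2 ⟨hPi, h⟩⟩
    push Not at this
    obtain ⟨w', hw', hle⟩ := this
    have hit : i + 1 < t := by
      refine lt_of_le_of_ne hi fun h => ?_
      rw [h, hAt] at hw'
      simp at hw'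
    exact ⟨hit, ((hP _ v hit).2.1 w' hw').trans (hle.trans (graphDist_triangle hG hpos _ _ _))⟩
  · rintro v w hvw ⟨k, hk, hw⟩
    obtain ⟨hwA, hwlt⟩ := mem_bunch.1 hw
    obtain ⟨hadj, heq⟩ := hnx v w hvw
    have hedge : d (nx v w) v ≤ wt s(v, nx v w) := by
      have := graphDist_le_walkWeight hpos (SimpleGraph.Walk.cons hadj SimpleGraph.Walk.nil)
      rw [walkWeight_cons] at this
      rw [hd, graphDist_comm hG hpos]
      simpa [walkWeight] using this
    refine ⟨k, hk, mem_bunch.2 ⟨hwA, fun w' hw' => ?_⟩⟩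
    have h1 := hwlt w' hw'
    have h2 := graphDist_triangle hG hpos w' (nx v w) v
    rw [hd] at h1 hedge ⊢
    rw [graphDist_comm hG hpos w v] at h1
    rw [graphDist_comm hG hpos w (nx v w)]
    linarith
  · refine le_trans ?_ hcost
    rw [Nat.card_eq_fintype_card, Fintype.card_subtype, Nat.cast_le]
    calc _ ≤ ((Finset.range t).sigma fun k =>
          (Finset.univ : Finset V).sigma fun v => bunch d (A k) (A (k + 1)) v).card := ?_
      _ = _ := by rw [Finset.card_sigma]; simp only [Finset.card_sigma]
    refine Finset.card_le_card_of_surjOn (fun z => (z.2.1, z.2.2)) ?_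
    rintro ⟨v, w⟩ hvw
    obtain ⟨k, hk, hw⟩ := (Finset.mem_filter.1 (Finset.mem_coe.1 hvw)).2
    exact ⟨⟨k, v, w⟩, by simpa using ⟨hk, hw⟩, rfl⟩

end Bunches

/-! ### The encoding of the oracle -/

section Encoding

variable {V : Type*} {G : SimpleGraph V} {wt : Sym2 V → ℝ} {n : ℕ} {name : V ≃ Fin n}
  {W : ℕ} {D : Store} {t L : ℕ} {tab : ℕ → ℕ → ℕ} {lev : V → ℕ} {B : V → V → Prop}
  {P : ℕ → V → V} {nx : V → V → V}

/-- The tables `tab` of the store `D` represent the levels, the bunches with the distances and next hops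
of their elements, and the pivots. -/
structure Encodes (G : SimpleGraph V) (wt : Sym2 V → ℝ) (name : V ≃ Fin n) (W : ℕ) (D : Store)
    (t L : ℕ) (tab : ℕ → ℕ → ℕ) (lev : V → ℕ) (B : V → V → Prop) (P : ℕ → V → V)
    (nx : V → V → V) : Prop extends Layout W D n t L tab where
  lev_eq : ∀ v, tab 1 (name v) = lev v
  hasEntry_iff : ∀ v w, HasEntry n tab (name v) (name w) ↔ B v w
  next_eq : ∀ v w, B v w → tab 5 (cell tab (name v) (name w)) = name (nx v w)
  dist_eq : ∀ v w, B v w → D.dists.getD (cell tab (name v) (name w)) 0 = graphDist G wt v w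
  pivot_eq : ∀ i < t, ∀ u, tab 6 (i * n + name u) = name (P i u)

/-- The invariant of the search is that, after `m` steps, the current pivot of the current vertex `u`
is at distance at most `m * d(X, Y)` from `u`. -/
theorem reach_search_vertices (hG : G.Connected) (hpos : ∀ e ∈ G.edgeSet, 0 < wt e)
    (hD : Encodes G wt name W D t L tab lev B P nx)
    (hB : BunchSystem (graphDist G wt) nx lev t B P) (X Y : V) :
    Reach W D search (queryState (name X) (name Y)) (34 * (t - max (lev X) (lev Y)) + 50)
      fun s => ∃ (i u v : ℕ) (w : V), SearchState n (name X) (name Y) i u v s ∧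
        s.reg 6 = name w ∧ B X w ∧ B Y w ∧ graphDist G wt X w + graphDist G wt Y w ≤
          (2 * ((t - max (lev X) (lev Y) : ℕ) : ℝ) - 1) * graphDist G wt X Y := by
  set d := graphDist G wt with hd
  set lv := max (lev X) (lev Y) with hlv
  have hcomm : ∀ u v, d u v = d v u := graphDist_comm hG hpos
  have htri : ∀ u v w, d u w ≤ d u v + d v w := graphDist_triangle hG hpos
  have hΔ : 0 ≤ d X Y := graphDist_nonneg hpos X Y
  let I : ℕ → ℕ → ℕ → Prop := fun i u v => ∃ U U' : V, u = name U ∧ v = name U' ∧ i < t ∧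
    lv ≤ i ∧ ((U = X ∧ U' = Y) ∨ (U = Y ∧ U' = X)) ∧ d (P i U) U ≤ ((i - lv : ℕ) : ℝ) * d X Y
  have hdUU : ∀ U U', ((U = X ∧ U' = Y) ∨ (U = Y ∧ U' = X)) → d U U' = d X Y := by
    rintro U U' (⟨rfl, rfl⟩ | ⟨rfl, rfl⟩)
    · rfl
    · exact hcomm _ _
  have hlevt : ∀ v, lev v < t := fun v => hD.lev_eq v ▸ hD.lev_lt _ (name v).2
  have hsearch := reach_search (D := D) (W := W) hD.toLayout (I := I) (name X).2 (name Y).2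
    ?_ ?_ ?_ ?_
  · rw [hD.lev_eq, hD.lev_eq] at hsearch
    refine hsearch.mono le_rfl ?_
    rintro s ⟨i, u, v, ⟨U, U', rfl, rfl, hi, hlvi, hUU, hdist⟩, hs, h6, hent⟩
    rw [hD.pivot_eq i hi] at h6 hent
    rw [hD.hasEntry_iff] at hent
    have hBU := hB.pivot_mem i hi U
    have hUw : d U (P i U) + d U' (P i U) ≤ (2 * ((t - lv : ℕ) : ℝ) - 1) * d X Y := by
      have h1 : d U' (P i U) ≤ d X Y + d (P i U) U := by
        rw [← hdUU U U' hUU, hcomm U U', hcomm (P i U) U]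
        exact htri _ _ _
      have h2 : ((i - lv : ℕ) : ℝ) ≤ ((t - lv : ℕ) : ℝ) - 1 := by
        have : (i - lv) + 1 ≤ t - lv := by omega
        have : (((i - lv) + 1 : ℕ) : ℝ) ≤ ((t - lv : ℕ) : ℝ) := Nat.cast_le.2 this
        push_cast at this
        linarith
      have h3 := mul_le_mul_of_nonneg_right h2 hΔ
      rw [hcomm U]
      linarith
    rcases hUU with ⟨rfl, rfl⟩ | ⟨rfl, rfl⟩
    · exact ⟨i, _, _, _, hs, h6, hBU, hent, hUw⟩
    · exact ⟨i, _, _, _, hs, h6, hent, hBU, by linarith⟩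
  · rintro i u v ⟨U, U', rfl, rfl, hi, -⟩
    exact ⟨hi, (name U).2, (name U').2⟩
  · rintro i u v ⟨U, U', rfl, rfl, hi, hlvi, hUU, hdist⟩ hent
    rw [hD.pivot_eq i hi, hD.hasEntry_iff] at hent
    obtain ⟨hi', hstep⟩ := hB.step i hi U U' hent
    refine ⟨U', U, rfl, rfl, hi', by omega, hUU.symm.imp And.symm And.symm, ?_⟩
    rw [hdUU U U' hUU] at hstep
    rw [show i + 1 - lv = (i - lv) + 1 by omega]
    push_cast
    linarith
  · intro h
    rw [hD.lev_eq, hD.lev_eq] at h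
    rw [hD.lev_eq]
    have hlv' : lv = lev Y := max_eq_right h.le
    exact ⟨Y, X, rfl, rfl, hlevt Y, hlv'.le, Or.inr ⟨rfl, rfl⟩,
      (hB.pivot_lev Y).trans (mul_nonneg (Nat.cast_nonneg _) hΔ)⟩
  · intro h
    rw [hD.lev_eq, hD.lev_eq] at h
    rw [hD.lev_eq]
    have hlv' : lv = lev X := max_eq_left (not_lt.1 h)
    exact ⟨X, Y, rfl, rfl, hlevt X, hlv'.le, Or.inl ⟨rfl, rfl⟩,
      (hB.pivot_lev X).trans (mul_nonneg (Nat.cast_nonneg _) hΔ)⟩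

theorem answersDistance (hG : G.Connected) (hpos : ∀ e ∈ G.edgeSet, 0 < wt e)
    (hD : Encodes G wt name W D t L tab lev B P nx)
    (hB : BunchSystem (graphDist G wt) nx lev t B P) (X Y : V) :
    AnswersDistance G wt name W D distanceQuery X Y
      (2 * ((t - max (lev X) (lev Y) : ℕ) : ℝ) - 1) (34 * (t - max (lev X) (lev Y)) + 77) := by
  obtain ⟨s, T, hT, hrun, hs⟩ : Reach W D distanceQuery (queryState (name X) (name Y)) _ _ :=
    (reach_search_vertices hG hpos hD hB X Y).seq (T₂ := 27)
      (Q := fun s => graphDist G wt X Y ≤ s.dreg 0 ∧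
        s.dreg 0 ≤ (2 * ((t - max (lev X) (lev Y) : ℕ) : ℝ) - 1) * graphDist G wt X Y) (by
      rintro s ⟨i, u, v, w, hs, h6, hX, hY, hle⟩
      refine (reach_distanceQuery_tail hD.toLayout (name X).2 (name Y).2 (name w).2 hs h6).mono
        le_rfl fun s' hs' => ?_
      rw [hs', hD.dist_eq _ _ hX, hD.dist_eq _ _ hY]
      refine ⟨?_, hle⟩
      rw [graphDist_comm hG hpos Y w]
      exact graphDist_triangle hG hpos X w Y)
  exact ⟨T, s, hrun, by omega, hs⟩

/-- The vertices on the path from `v` to `w` that the next hops describe all have `w` in their bunch. -/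
theorem mem_bunch_getVert (hB : BunchSystem (graphDist G wt) nx lev t B P) {v w : V}
    (hvw : B v w) (p : G.Walk v w) (hne : ∀ k < p.length, p.getVert k ≠ w)
    (hnext : ∀ k < p.length, p.getVert (k + 1) = nx (p.getVert k) w) :
    ∀ k ≤ p.length, B (p.getVert k) w := by
  intro k
  induction k with
  | zero => intro _; simpa using hvw
  | succ k ih =>
    intro hk
    rw [hnext k hk]
    exact hB.next_mem _ _ (hne k hk) (ih (by omega))

theorem reportsPath (hG : G.Connected) (hpos : ∀ e ∈ G.edgeSet, 0 < wt e) (hnx : IsNextHop G wt nx)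
    (hD : Encodes G wt name W D t L tab lev B P nx)
    (hB : BunchSystem (graphDist G wt) nx lev t B P) (X Y : V) :
    ReportsPath G wt name W D pathQuery X Y
      (2 * ((t - max (lev X) (lev Y) : ℕ) : ℝ) - 1) 46 (34 * (t - max (lev X) (lev Y)) + 68) := by
  have : Fintype V := Fintype.ofEquiv _ name.symm
  have hcard : Fintype.card V = n := by simpa using Fintype.card_congr name
  have hsz := hD.size_lt
  have hn := hD.n_le
  obtain ⟨s, T₁, hT₁, hrun₁, i, u, v, w, hs, h6, hX, hY, hle⟩ :=
    reach_search_vertices hG hpos hD hB X Y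
  obtain ⟨p, hp1, hp2, hp3, hp4⟩ := exists_geodesic hpos hnx X w
  obtain ⟨p', hp1', hp2', hp3', hp4'⟩ := exists_geodesic hpos hnx Y w
  have hpB := mem_bunch_getVert hB hX p hp3 hp4
  have hpB' := mem_bunch_getVert hB hY p' hp3' hp4'
  rw [hcard] at hp2 hp2'
  have hinj : ∀ a b : V, (name a : ℕ) = name b → a = b := fun a b h =>
    name.injective (Fin.ext h)
  obtain ⟨s', T₂, hT₂, hrun₂, h0, hout, hout'⟩ :=
    reach_pathQuery_tail (D := D) (W := W) (s := s) hD.toLayout (name w).2 hs h6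
      (f := fun k => name (p.getVert k)) (f' := fun k => name (p'.getVert k)) (len := p.length)
      (len' := p'.length) (fun k _ => (name _).2) (fun k _ => (name _).2)
      (by simp) (by simp) (fun k hk h => hp3 k hk (hinj _ _ h)) (fun k hk h => hp3' k hk (hinj _ _ h))
      (fun k hk => by rw [hD.next_eq _ _ (hpB k hk.le), hp4 k hk])
      (fun k hk => by rw [hD.next_eq _ _ (hpB' k hk.le), hp4' k hk]) (by omega) (by simp) (by simp)
  refine ⟨T₁ + T₂, s', p.append p'.reverse, hrun₁.seq hrun₂, ?_, ?_, ?_, ?_⟩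
  · rw [SimpleGraph.Walk.length_append, SimpleGraph.Walk.length_reverse]
    omega
  · rw [SimpleGraph.Walk.length_append, SimpleGraph.Walk.length_reverse, h0]
  · intro k hk
    rw [SimpleGraph.Walk.length_append, SimpleGraph.Walk.length_reverse] at hk
    rw [SimpleGraph.Walk.getVert_append]
    split_ifs with hlt
    · exact hout k hlt.le
    · rw [SimpleGraph.Walk.getVert_reverse, ← hout' _ (Nat.sub_le _ _)]
      congr 1
      omega
  · rw [walkWeight_append, walkWeight_reverse, hp1, hp1']
    exact hle

/-- The eight tables, see `Layout`. -/
def oracleTable (n : ℕ) (level col row key next pivot : ℕ → ℕ) : ℕ → ℕ → ℕ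
  | 0, _ => n
  | 1, k => level k
  | 2, k => col k
  | 3, k => row k
  | 4, k => key k
  | 5, k => next k
  | 6, k => pivot k
  | _, _ => 0

theorem exists_encodes (hpos : ∀ e ∈ G.edgeSet, 0 < wt e) (hn : 2 ≤ n)
    (name : V ≃ Fin n) (htn : t ≤ n) (hlev : ∀ v, lev v < t) (B : V → V → Prop)
    (P : ℕ → V → V) (nx : V → V → V) :
    ∃ (D : Store) (L : ℕ) (tab : ℕ → ℕ → ℕ),
      Encodes G wt name (wordSize 8 n) D t L tab lev B P nx ∧
      D.WellFormed G wt (wordSize 8 n) ∧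
      D.space = 9 * (t * n + 4 * Nat.card {e : V × V // B e.1 e.2} + 2 * n + 1) := by
  classical
  have : Fintype V := Fintype.ofEquiv _ name.symm
  let nm : V × V → ℕ × ℕ := fun e => (name e.1, name e.2)
  have hnm : Function.Injective nm := fun e e' h => by
    have h1 := congrArg Prod.fst h
    have h2 := congrArg Prod.snd h
    exact Prod.ext (name.injective (Fin.ext h1)) (name.injective (Fin.ext h2))
  let K : Finset (ℕ × ℕ) := (Finset.univ.filter fun e : V × V => B e.1 e.2).image nm
  have hK : K.card = Nat.card {e : V × V // B e.1 e.2} := by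
    rw [Finset.card_image_of_injective _ hnm, Nat.card_eq_fintype_card, Fintype.card_subtype]
  have hKn : K.card ≤ n * n := by
    refine (Finset.card_image_le.trans (Finset.card_le_univ _)).trans ?_
    rw [Fintype.card_prod, Fintype.card_congr name, Fintype.card_fin]
  obtain ⟨C, R, hC, hR, hinj⟩ := exists_dictionary K
  rw [← hK]
  set N := K.card with hN
  set L := t * n + 4 * N + 2 * n + 1 with hL
  let loc : V × V → ℕ := fun e => R (name e.1 + C (name e.2)) + name e.2
  -- The pair whose entry is stored in a given cell of the dictionary.
  let ent : ℕ → Option (V × V) := fun k =>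
    if h : ∃ e : V × V, B e.1 e.2 ∧ loc e = k then some h.choose else none
  have hmemK : ∀ e : V × V, B e.1 e.2 → nm e ∈ (K : Set (ℕ × ℕ)) := fun e he =>
    Finset.mem_coe.2 (Finset.mem_image_of_mem nm (by simpa using he))
  have hent : ∀ e : V × V, B e.1 e.2 → ent (loc e) = some e := fun e he => by
    have hex : ∃ e' : V × V, B e'.1 e'.2 ∧ loc e' = loc e := ⟨e, he, rfl⟩
    have := hex.choose_spec
    simp only [ent, hex, dif_pos]
    exact congrArg some (hnm (hinj (hmemK _ this.1) (hmemK _ he) this.2))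
  have hent' : ∀ k e, ent k = some e → B e.1 e.2 := fun k e he => by
    simp only [ent] at he
    split_ifs at he with h
    exact Option.some.inj he ▸ h.choose_spec.1
  let vx : ℕ → V := fun k => name.symm ⟨k % n, Nat.mod_lt _ (by omega)⟩
  have hvx : ∀ v, vx (name v) = v := fun v => by
    have : (⟨(name v : ℕ) % n, Nat.mod_lt _ (by omega)⟩ : Fin n) = name v :=
      Fin.ext (Nat.mod_eq_of_lt (name v).2)
    simp only [vx, this, Equiv.symm_apply_apply]
  let key : ℕ → ℕ := fun k => (ent k).elim (n * n) fun e => name e.1 * n + name e.2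
  let next : ℕ → ℕ := fun k => (ent k).elim 0 fun e => name (nx e.1 e.2)
  let tab := oracleTable n (fun k => lev (vx k)) C R key next fun k => name (P (k / n) (vx k))
  let dist : ℕ → ℝ := fun k => (ent k).elim 0 fun e => graphDist G wt e.1 e.2
  have hkey : ∀ k, key k ≤ n * n := fun k => by
    simp only [key]
    cases ent k with
    | none => exact le_rfl
    | some e => exact (mul_add_lt_mul (name e.1).2 (name e.2).2).le
  have hnext : ∀ k, next k < n := fun k => by
    simp only [next]
    cases ent k with
    | none => simp only [Option.elim]; omega
    | some e => exact (name _).2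
  have htn' : t * n ≤ n * n := Nat.mul_le_mul_right n htn
  have hnn : n ≤ n * n := by nlinarith
  have hcell : ∀ v w, cell tab v w = R (v + C w) + w := fun v w => rfl
  have hW : 8 * L < 2 ^ wordSize 8 n ∧ n * n < 2 ^ wordSize 8 n := by
    rw [wordSize, Nat.mul_comm 8 (Nat.log 2 n + 1), pow_mul]
    set M := 2 ^ (Nat.log 2 n + 1) with hM
    have hnM : n < M := Nat.lt_pow_succ_log_self (by norm_num) n
    have h1 : n * n ≤ M * M := Nat.mul_le_mul hnM.le hnM.le
    have h2 : 3 ≤ M := by omega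
    have h3 : 3 ^ 6 * (M * M) ≤ M ^ 8 := by
      calc 3 ^ 6 * (M * M) ≤ M ^ 6 * (M * M) :=
            Nat.mul_le_mul_right _ (Nat.pow_le_pow_left h2 6)
        _ = M ^ 8 := by ring
    constructor <;> omega
  obtain ⟨hW, hnnW⟩ := hW
  refine ⟨⟨(List.range (8 * L)).map fun a => tab (a % 8) (a / 8), (List.range L).map dist⟩, L, tab,
    ⟨⟨rfl, hW, by omega, by omega, hnnW, rfl, fun v _ => hlev _, ?_, ?_, fun k _ => hkey k,
      fun i _ u _ => (name _).2⟩, ?_, ?_, ?_, ?_, ?_⟩, ⟨?_, ?_⟩, ?_⟩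
  · intro v hv w hw
    have := hC w
    change v + C w < L
    omega
  · intro v hv w hw
    have := hR (v + C w)
    change R (v + C w) + w < L
    omega
  · exact fun v => congrArg lev (hvx v)
  · intro v w
    change key (loc (v, w)) = name v * n + name w ↔ B v w
    constructor
    · intro h
      simp only [key] at h
      cases he : ent (loc (v, w)) with
      | none =>
        have := mul_add_lt_mul (name v).2 (name w).2
        rw [he] at h
        simp only [Option.elim] at h
        omega
      | some e =>
        rw [he] at h
        simp only [Option.elim] at h
        have h1 := congrArg (· / n) h
        have h2 := congrArg (· % n) h
        have hn0 : 0 < n := by omega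
        simp only [mul_comm _ n, Nat.mul_add_div hn0, Nat.mul_add_mod,
          Nat.div_eq_of_lt (Fin.is_lt _), Nat.mod_eq_of_lt (Fin.is_lt _), add_zero] at h1 h2
        have : e = (v, w) := hnm (Prod.ext h1 h2)
        subst this
        exact hent' _ _ he
    · intro h
      simp only [key, hent (v, w) h, Option.elim]
  · intro v w h
    change next (loc (v, w)) = name (nx v w)
    simp only [next, hent (v, w) h, Option.elim]
  · intro v w h
    have hlt : loc (v, w) < L := by
      have := hR (name v + C (name w))
      have := (name w).2
      simp only [loc]
      omega
    rw [hcell]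
    change ((List.range L).map dist).getD (loc (v, w)) 0 = _
    rw [List.getD_eq_getElem?_getD, List.getElem?_map, List.getElem?_range hlt]
    simp only [dist, Option.map_some, Option.getD_some, hent (v, w) h, Option.elim]
  · intro i _ u
    change ((name (P ((i * n + name u) / n) (vx (i * n + name u))) : Fin n) : ℕ) = name (P i u)
    have h1 : (i * n + name u) / n = i := by
      rw [mul_comm, Nat.mul_add_div (by omega), Nat.div_eq_of_lt (name u).2, add_zero]
    have h2 : vx (i * n + name u) = u := by
      have h3 : (i * n + name u) % n = name u := by
        rw [mul_comm, Nat.mul_add_mod, Nat.mod_eq_of_lt (name u).2]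
      have h4 : (⟨(i * n + name u) % n, Nat.mod_lt _ (by omega)⟩ : Fin n) = name u := Fin.ext h3
      simp only [vx, h4, Equiv.symm_apply_apply]
    rw [h1, h2]
  · intro a ha
    obtain ⟨k, -, rfl⟩ := List.mem_map.1 ha
    have h1 := hlev (vx (k / 8))
    have h2 := hC (k / 8)
    have h3 := hR (k / 8)
    have h4 := hkey (k / 8)
    have h5 := hnext (k / 8)
    have h6 := (name (P (k / 8 / n) (vx (k / 8)))).2
    simp only [tab]
    generalize k % 8 = r
    match r with
    | 0 | 1 | 2 | 3 | 4 | 5 | 6 | _ + 7 => simp only [oracleTable]; omega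
  · intro a ha
    obtain ⟨k, -, rfl⟩ := List.mem_map.1 ha
    simp only [dist]
    cases ent k with
    | none => exact ⟨vx 0, vx 0, (graphDist_self hpos _).symm⟩
    | some e => exact ⟨e.1, e.2, rfl⟩
  · simp [Store.space]
    omega

end Encoding

/-! ### Priority levels -/

section Priority

theorem priorityLevel_mono_left {t t' : ℕ} (h : t' ≤ t) (n : ℕ) {j : ℕ} (hj : 1 ≤ j) :
    priorityLevel t' n j ≤ priorityLevel t n j := by
  have hj' : 0 ≤ Real.log j := Real.log_nonneg (by exact_mod_cast hj)
  have hn : 0 ≤ Real.log n := Real.log_natCast_nonneg n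
  refine max_le_max le_rfl (Nat.ceil_mono ?_)
  gcongr

theorem priorityLevel_mono_right (t n : ℕ) {j j' : ℕ} (hj : 1 ≤ j) (h : j ≤ j') :
    priorityLevel t n j ≤ priorityLevel t n j' := by
  have hn : 0 ≤ Real.log n := Real.log_natCast_nonneg n
  refine max_le_max le_rfl (Nat.ceil_mono ?_)
  gcongr

theorem priorityLevel_le {t n j : ℕ} (ht : 1 ≤ t) (hn : 2 ≤ n) (hj : 1 ≤ j) (hjn : j ≤ n) :
    priorityLevel t n j ≤ t := by
  have hlog : 0 < Real.log n := Real.log_pos (by exact_mod_cast hn)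
  refine max_le ht (Nat.ceil_le.2 ?_)
  rw [div_le_iff₀ hlog]
  gcongr

/-- The vertices of priority level at most `k` are the first `n ^ (k / t)` ones in the ranking. -/
theorem le_pow_of_priorityLevel_le {t n j k : ℕ} (ht : 1 ≤ t) (hn : 2 ≤ n) (hj : 1 ≤ j)
    (h : priorityLevel t n j ≤ k) : (j : ℝ) ≤ ((n : ℝ) ^ (1 / (t : ℝ))) ^ k := by
  have hlog : 0 < Real.log n := Real.log_pos (by exact_mod_cast hn)
  have ht' : (0 : ℝ) < t := by exact_mod_cast ht
  have hn' : (0 : ℝ) < n := by exact_mod_cast (by omega : 0 < n)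
  have h1 := Nat.ceil_le.1 ((le_max_right _ _).trans h)
  rw [div_le_iff₀ hlog] at h1
  have h2 : Real.log j ≤ Real.log n * (1 / t * k) := by
    rw [one_div_mul_eq_div, mul_div_assoc', le_div_iff₀ ht']
    linarith
  rw [← Real.rpow_natCast, ← Real.rpow_mul hn'.le, Real.rpow_def_of_pos hn',
    ← Real.log_le_iff_le_exp (by exact_mod_cast hj)]
  exact h2

/-- More than `n` levels are of no use: `n ^ (1 / n) ≤ 2`. -/
theorem min_mul_rpow_le {t n : ℕ} (ht : 1 ≤ t) (hn : 1 ≤ n) :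
    ((min t n : ℕ) : ℝ) * (n : ℝ) ^ (1 / ((min t n : ℕ) : ℝ)) ≤ 2 * (t * (n : ℝ) ^ (1 / (t : ℝ))) := by
  have hn' : (1 : ℝ) ≤ n := by exact_mod_cast hn
  have ht' : (0 : ℝ) < t := by exact_mod_cast ht
  rcases le_total t n with h | h
  · rw [min_eq_left h]
    have : 0 ≤ (t : ℝ) * (n : ℝ) ^ (1 / (t : ℝ)) := by positivity
    linarith
  · rw [min_eq_right h]
    have h1 : (1 : ℝ) ≤ (n : ℝ) ^ (1 / (t : ℝ)) := Real.one_le_rpow hn' (by positivity)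
    have h2 : (n : ℝ) ^ (1 / (n : ℝ)) ≤ 2 := by
      calc (n : ℝ) ^ (1 / (n : ℝ)) ≤ ((2 : ℝ) ^ n) ^ (1 / (n : ℝ)) :=
            Real.rpow_le_rpow (by positivity) (by exact_mod_cast Nat.lt_two_pow_self.le)
              (by positivity)
        _ = 2 := by
            rw [one_div]
            exact Real.pow_rpow_inv_natCast (by norm_num) (by omega)
    have h3 : (n : ℝ) ≤ t := by exact_mod_cast h
    calc (n : ℝ) * (n : ℝ) ^ (1 / (n : ℝ)) ≤ t * 2 := by gcongr
      _ ≤ 2 * (t * (n : ℝ) ^ (1 / (t : ℝ))) := by nlinarith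

end Priority

/-! ### The oracle -/

theorem AnswersDistance.mono {V : Type*} {G : SimpleGraph V} {wt : Sym2 V → ℝ}
    (hpos : ∀ e ∈ G.edgeSet, 0 < wt e) {n : ℕ} {name : V ≃ Fin n} {W : ℕ} {D : Store} {P : Prog}
    {u v : V} {α α' : ℝ} {τ τ' : ℕ} (h : AnswersDistance G wt name W D P u v α τ) (hα : α ≤ α')
    (hτ : τ ≤ τ') : AnswersDistance G wt name W D P u v α' τ' := by
  obtain ⟨T, s, h1, h2, h3, h4⟩ := h
  exact ⟨T, s, h1, h2.trans hτ, h3,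
    h4.trans (mul_le_mul_of_nonneg_right hα (graphDist_nonneg hpos u v))⟩

theorem ReportsPath.mono {V : Type*} {G : SimpleGraph V} {wt : Sym2 V → ℝ}
    (hpos : ∀ e ∈ G.edgeSet, 0 < wt e) {n : ℕ} {name : V ≃ Fin n} {W : ℕ} {D : Store} {P : Prog}
    {u v : V} {α α' : ℝ} {κ κ' τ τ' : ℕ} (h : ReportsPath G wt name W D P u v α κ τ) (hα : α ≤ α')
    (hκ : κ ≤ κ') (hτ : τ ≤ τ') : ReportsPath G wt name W D P u v α' κ' τ' := by
  obtain ⟨T, s, p, h1, h2, h3, h4, h5⟩ := h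
  exact ⟨T, s, p, h1, h2.trans (Nat.add_le_add (Nat.mul_le_mul_right _ hκ) hτ), h3, h4,
    h5.trans (mul_le_mul_of_nonneg_right hα (graphDist_nonneg hpos u v))⟩

theorem theorem6 :
    ∃ (C c : ℕ) (distProg pathProg : Prog),
      ∀ (V : Type*) (G : SimpleGraph V) (wt : Sym2 V → ℝ) (n : ℕ)
        (name : V ≃ Fin n) (x : Fin n ≃ V) (t : ℕ),
        G.Connected → (∀ e ∈ G.edgeSet, 0 < wt e) → 1 ≤ t →
        ∃ D : Store,
          D.WellFormed G wt (wordSize c n) ∧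
          (D.space : ℝ) ≤ C * t * (n : ℝ) ^ (1 + 1 / (t : ℝ)) ∧
          ∀ i j : Fin n, j < i → ∀ u v : V, (u = x j ∧ v = x i) ∨ (u = x i ∧ v = x j) →
            AnswersDistance G wt name (wordSize c n) D distProg u v
              (2 * (priorityLevel t n (j + 1) : ℝ) - 1) (C * priorityLevel t n (j + 1)) ∧
            ReportsPath G wt name (wordSize c n) D pathProg u v
              (2 * (priorityLevel t n (j + 1) : ℝ) - 1) C (C * priorityLevel t n (j + 1)) := by
  refine ⟨216, 8, distanceQuery, pathQuery, fun V G wt n name x t hG hpos ht => ?_⟩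
  rcases Nat.lt_or_ge n 2 with hn | hn
  -- With fewer than two vertices there are no queries.
  · refine ⟨⟨[], []⟩, ⟨by simp, by simp⟩, ?_, fun i j hij => absurd hij ?_⟩
    · simp only [Store.space, List.length_nil, add_zero, Nat.cast_zero]
      positivity
    · intro h
      have := i.2
      have : (j : ℕ) < i := h
      omega
  have : Fintype V := Fintype.ofEquiv _ name.symm
  have hcard : Fintype.card V = n := by simpa using Fintype.card_congr name
  set t' := min t n with ht'
  have ht1 : 1 ≤ t' := le_min ht (by omega)
  have hn1 : (1 : ℝ) ≤ n := by exact_mod_cast (by omega : 1 ≤ n)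
  set q : ℝ := (n : ℝ) ^ (1 / (t' : ℝ)) with hq
  have hq1 : 1 ≤ q := Real.one_le_rpow hn1 (by positivity)
  have hqt : q ^ t' = Fintype.card V := by
    rw [hcard, hq, one_div]
    exact Real.rpow_inv_natCast_pow (by positivity) (by omega)
  -- The level from which a vertex of priority level `k` starts has `k` levels from it upwards.
  let lev : V → ℕ := fun v => t' - priorityLevel t' n ((x.symm v : ℕ) + 1)
  have hk1 : ∀ j, 1 ≤ priorityLevel t' n j := fun j => le_max_left _ _
  have hkt : ∀ j : Fin n, priorityLevel t' n ((j : ℕ) + 1) ≤ t' := fun j =>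
    priorityLevel_le ht1 hn (by omega) j.2
  have hlev : ∀ v, lev v < t' := fun v => by
    have := hk1 ((x.symm v : ℕ) + 1)
    simp only [lev]
    omega
  have hS : ∀ i < t', (Nat.card {v // i ≤ lev v} : ℝ) ≤ q ^ (t' - i) := fun i hi => by
    have hle : ∀ v, i ≤ lev v → ((x.symm v : ℕ) + 1 : ℕ) ≤ q ^ (t' - i) := fun v hv => by
      have h1 := hkt (x.symm v)
      exact le_pow_of_priorityLevel_le ht1 hn (by omega) (by simp only [lev] at hv; omega)
    rw [← Nat.le_floor_iff (by positivity)]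
    have hinj := Nat.card_le_card_of_injective
      (fun v : {v // i ≤ lev v} => (⟨(x.symm v.1 : ℕ), by
        have := Nat.le_floor (hle v.1 v.2)
        omega⟩ : Fin ⌊q ^ (t' - i)⌋₊)) (fun v v' h => Subtype.ext (x.symm.injective
          (Fin.ext (Fin.mk.inj h))))
    simpa using hinj
  have htop : ∃ v, lev v = t' - 1 := ⟨x ⟨0, by omega⟩, by simp [lev, priorityLevel]⟩
  obtain ⟨nx, hnx⟩ : ∃ nx, IsNextHop G wt nx := exists_isNextHop hG hpos
  obtain ⟨B, P, hB, hcost⟩ := exists_bunchSystem hG hpos hnx hq1 ht1 hqt hlev hS htop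
  obtain ⟨D, L, tab, hD, hwf, hspace⟩ :=
    exists_encodes hpos hn name (min_le_right t n) hlev B P nx
  refine ⟨D, hwf, ?_, fun i j hij u v huv => ?_⟩
  · have h1 := min_mul_rpow_le ht (by omega : 1 ≤ n)
    rw [← ht', ← hq] at h1
    have h2 : (n : ℝ) ^ (1 + 1 / (t : ℝ)) = n * (n : ℝ) ^ (1 / (t : ℝ)) := by
      rw [Real.rpow_add (by linarith), Real.rpow_one]
    have h3 : (1 : ℝ) ≤ t' := by exact_mod_cast ht1
    have h4 : (t' : ℝ) * n ≤ t' * (n * q) := by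
      have : (n : ℝ) * 1 ≤ n * q := by gcongr
      rw [mul_one] at this
      gcongr
    have h5 : (n : ℝ) ≤ t' * n := by nlinarith
    rw [hcard] at hcost
    rw [hspace, h2, ← ht']
    push_cast
    have h6 : (t' : ℝ) * (n * q) ≤ n * (2 * (t * (n : ℝ) ^ (1 / (t : ℝ)))) := by
      calc (t' : ℝ) * (n * q) = n * (t' * q) := by ring
        _ ≤ _ := by gcongr
    linarith
  · -- The smaller rank determines the larger one of the two starting levels.
    have hji : (j : ℕ) ≤ i := le_of_lt hij
    have hmono := priorityLevel_mono_right t' n (j := (j : ℕ) + 1) (j' := (i : ℕ) + 1) (by omega)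
      (by omega)
    have hkj := hkt j
    have hki := hkt i
    have hmax : t' - max (lev u) (lev v) = priorityLevel t' n ((j : ℕ) + 1) := by
      rcases huv with ⟨rfl, rfl⟩ | ⟨rfl, rfl⟩ <;> simp only [lev, Equiv.symm_apply_apply] <;> omega
    have hk : priorityLevel t' n ((j : ℕ) + 1) ≤ priorityLevel t n ((j : ℕ) + 1) :=
      priorityLevel_mono_left (min_le_left t n) n (by omega)
    have hkR : (2 * (priorityLevel t' n ((j : ℕ) + 1) : ℝ) - 1) ≤
        2 * (priorityLevel t n ((j : ℕ) + 1) : ℝ) - 1 := by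
      have : (priorityLevel t' n ((j : ℕ) + 1) : ℝ) ≤ priorityLevel t n ((j : ℕ) + 1) := by
        exact_mod_cast hk
      linarith
    have h1 := hk1 ((j : ℕ) + 1)
    have hd := answersDistance hG hpos hD hB u v
    have hp := reportsPath hG hpos hnx hD hB u v
    rw [hmax] at hd hp
    exact ⟨hd.mono hpos hkR (by omega), hp.mono hpos hkR (by norm_num) (by omega)⟩
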